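/- Consider the closed loop formed by a nominal plant $\dot x_p=Ax_p+B\hat u$, $y=Cx_p+d$ with $y(t)\in\mathbb R^p$; an additive uncertainty $\Delta(s)=C_\Delta(sI-A_\Delta)^{-1}B_\Delta+D_\Delta\in\mathcal{RH}_\infty$ ($A_\Delta$ Hurwitz) with $\|\Delta\|_\infty=\sup_\omega\|\Delta(j\omega)\|\le\eta$, whose output is $d=\Delta\hat u$, i.e. $\dot\xi=A_\Delta\xi+B_\Delta\hat u$, $d=C_\Delta\xi+D_\Delta\hat u$, $\xi(0)=0$; and a controller $\dot x_k=A_kx_k+B_k\hat y$, $u=C_kx_k+D_k\hat y$ with $u(t)\in\mathbb R^m$; here $p+m>0$. The sampled outputs $\hat y,\hat u$ are piecewise constant: at triggering instants $0=t_0<t_1<\dots$ (finitely many, or $t_k\to\infty$) they are updated to $\hat y(t_k)=y(t_k)$, $\hat u(t_k)=u(t_k)$, and they are held constant on $[t_k,t_{k+1})$. Put $v=(\hat y,\hat u)$ and $\epsilon=(\hat y-y,\hat u-u)$, and let $$f(t)=|\epsilon(t)|^2-v(t)^T\begin{bmatrix}\Omega_1&\\&\Omega_2\end{bmatrix}v(t)-\mu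 e^{-\nu t},$$ with $\Omega_1,\Omega_2$ symmetric positive definite and $\mu,\nu>0$; $t_{k+1}$ is the first time $t>t_k$ at which $f\ge0$ (with the samples of $t_k$ still held), and $t_{k+1}=\infty$ if there is none. Let $\rho$ denote the spectral radius, $\gamma=\sqrt{\max\{\rho(\Omega_1),\rho(\Omega_2+\eta^2I)\}}$, and $\|g\|_2=(\int_0^\infty|g(t)|^2dt)^{1/2}$. For initial states $x_p(0),x_k(0)$, let $\Gamma$ be the operator mapping $v=(\hat y,\hat u)$ to $(\epsilon_y,\epsilon_u,d)$, where $$\epsilon_y(t)=\hat y(t)-Ce^{At}x_p(0)-\int_0^tCe^{A(t-\tau)}B\hat u(\tau)\,d\tau-d(t),\qquad d(t)=\int_0^tC_\Delta e^{A_\Delta(t-\tau)}B_\Delta\hat u(\tau)\,d\tau+D_\Delta\hat u(t),$$ $$\epsilon_u(t)=\hat u(t)-C_ke^{A_kt}x_k(0)-\int_0^tC_ke^{A_k(t-\tau)}B_k\hat y(\tau)\,d\tau-D_k\hat y(t).$$ Then: (a) $\Gamma$ is an affine operator on locally square integrable signals, with locally square integrable values. (b) On every run of the closed loop, $(\epsilon,d)=\Gamma(v)$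 and the triggering condition $f\le0$ holds for almost every $t\ge0$; moreover, for $t\in[t_k,t_{k+1})$, $$\epsilon_y(t)=\hat y(t)-Ce^{A(t-t_k)}x_p(t_k)-\int_{t_k}^tCe^{A(t-\tau)}B\hat u(\tau)\,d\tau-d(t),$$ $$\epsilon_u(t)=\hat u(t)-C_ke^{A_k(t-t_k)}x_k(t_k)-\int_{t_k}^tC_ke^{A_k(t-\tau)}B_k\hat y(\tau)\,d\tau-D_k\hat y(t).$$ (c) $\Gamma$ is finite-gain $\mathcal L_2$ stable with gain at most $\gamma>0$ under the triggering condition: for all initial states and every $v\in\mathcal L_2$ such that $f\le0$ almost everywhere, where $\epsilon$ is the $\epsilon$-part of $\Gamma(v)$ (in particular for every run with $v\in\mathcal L_2$), one has $\Gamma(v)\in\mathcal L_2$ and $$\|\Gamma(v)\|_2\le\gamma\|v\|_2+\sqrt{\mu/\nu},\qquad \|\Gamma(v)\|_2^2\le\gamma^2\|v\|_2^2+\frac{\mu}{\nu},$$ and, with the Fourier transforms $g(j\omega)$ of the signals $g$ (extended by zero to $t<0$), $$\int_{-\infty}^\infty|\Gamma(v)(j\omega)|^2\,d\omega\le\gamma^2\int_{-\infty}^\infty|v(j\omega)|^2\,d\omega+\frac{2\pi\mu}{\nu}.$$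 -/

import Mathlib

open MeasureTheory Set Matrix
open scoped Matrix.Norms.L2Operator

namespace ETC

noncomputable section

/-! ### Signals -/

/-- A vector-valued signal. Only its values at times `t ≥ 0` matter. -/
abbrev Signal (ι : Type) : Type := ℝ → ι → ℝ

/-- The signal is square integrable on `[0, ∞)`. -/
def MemL2 {ι : Type} [Fintype ι] (f : Signal ι) : Prop :=
  MemLp (fun t => WithLp.toLp 2 (f t)) 2 (volume.restrict (Ici (0 : ℝ)))

/-- The signal is square integrable on every bounded interval `[0, T]`. -/
def MemL2Loc {ι : Type} [Fintype ι] (f : Signal ι) : Prop :=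
  ∀ T : ℝ, MemLp (fun t => WithLp.toLp 2 (f t)) 2 (volume.restrict (Icc (0 : ℝ) T))

/-- The energy `∫₀^∞ fᵀ f dt`. -/
def energy {ι : Type} [Fintype ι] (f : Signal ι) : ℝ :=
  ∫ t in Ici (0 : ℝ), f t ⬝ᵥ f t

/-- The `L²` norm `(∫₀^∞ fᵀ f dt)^{1/2}`. -/
def l2norm {ι : Type} [Fintype ι] (f : Signal ι) : ℝ := √(energy f)

/-- The causal complex signal attached to `f`: equal to `f` on `[0, ∞)`, zero before. -/
def causal {ι : Type} (f : Signal ι) : ℝ → EuclideanSpace ℂ ι :=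
  (Ici (0 : ℝ)).indicator fun t => WithLp.toLp 2 fun i => (f t i : ℂ)

open scoped Classical FourierTransform in
/-- The (Plancherel) Fourier transform `f(jω)` of an `L²` signal on `[0, ∞)`, formally
`∫₀^∞ e^{-jωt} f(t) dt`. Mathlib's transform has the kernel `e^{-2πiξt}`, whence `ξ = ω / 2π`. -/
def freq {ι : Type} [Fintype ι] (f : Signal ι) (ω : ℝ) : EuclideanSpace ℂ ι :=
  if h : MemLp (causal f) 2 (volume : Measure ℝ) then
    (𝓕 (h.toLp (causal f)) : Lp (EuclideanSpace ℂ ι) 2 (volume : Measure ℝ)) (ω / (2 * Real.pi))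
  else 0

/-- `∫_{-∞}^∞ f(jω)^* f(jω) dω`. -/
def freqEnergy {ι : Type} [Fintype ι] (f : Signal ι) : ℝ := ∫ ω : ℝ, ‖freq f ω‖ ^ 2

/-! ### Operators on signals -/

/-- `Φ` maps locally square integrable signals to such signals, and is affine on them
(values at times `t ≥ 0`). -/
def IsAffineOperator {ι κ : Type} [Fintype ι] [Fintype κ] (Φ : Signal ι → Signal κ) : Prop :=
  (∀ v, MemL2Loc v → MemL2Loc (Φ v)) ∧
  ∀ v w, MemL2Loc v → MemL2Loc w → ∀ a t : ℝ, 0 ≤ t →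
    Φ (a • v + (1 - a) • w) t = a • Φ v t + (1 - a) • Φ w t

/-- `Φ`, with domain `dom`, is finite-gain `L²` stable with gain at most `γ` and bias `β`. -/
def FiniteGainOn {ι κ : Type} [Fintype ι] [Fintype κ] (dom : Set (Signal ι))
    (Φ : Signal ι → Signal κ) (γ β : ℝ) : Prop :=
  0 < γ ∧ 0 < β ∧
    ∀ v ∈ dom, MemL2 v → MemL2 (Φ v) ∧ l2norm (Φ v) ≤ γ * l2norm v + β

/-! ### Matrices and linear systems -/

/-- The complex matrix with the same entries. -/
def cplx {ι κ : Type} (M : Matrix ι κ ℝ) : Matrix ι κ ℂ := M.map fun x => (x : ℂ)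

/-- The spectral radius: the largest modulus of a complex eigenvalue. -/
def specRad {n : ℕ} (M : Matrix (Fin n) (Fin n) ℝ) : ℝ := (spectralRadius ℂ (cplx M)).toReal

/-- A linear system `x' = A x + B w`, `z = C x + D w`. -/
structure LTI (n i o : ℕ) where
  A : Matrix (Fin n) (Fin n) ℝ
  B : Matrix (Fin n) (Fin i) ℝ
  C : Matrix (Fin o) (Fin n) ℝ
  D : Matrix (Fin o) (Fin i) ℝ

namespace LTI

variable {n i o : ℕ}

/-- All eigenvalues of `A` lie in the open left half plane. -/
def Stable (G : LTI n i o) : Prop := ∀ z ∈ spectrum ℂ (cplx G.A), z.re < 0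

/-- The transfer function `C (s I - A)⁻¹ B + D`. -/
def transfer (G : LTI n i o) (s : ℂ) : Matrix (Fin o) (Fin i) ℂ :=
  cplx G.C * (s • (1 : Matrix (Fin n) (Fin n) ℂ) - cplx G.A)⁻¹ * cplx G.B + cplx G.D

/-- The `H∞` norm of a stable system: the supremum over the frequencies `ω` of the largest singular
value of the transfer function at `jω` (the matrix norm is the `ℓ²` operator norm). -/
def hinfNorm (G : LTI n i o) : ENNReal := ⨆ ω : ℝ, ‖G.transfer (Complex.I * (ω : ℂ))‖ₑ

/-- The output at time `t`, for the input `w` and the state `x₀` at time `t₀`. -/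
def outputFrom (G : LTI n i o) (t₀ : ℝ) (x₀ : Fin n → ℝ) (w : Signal (Fin i)) :
    Signal (Fin o) := fun t =>
  (G.C * NormedSpace.exp ((t - t₀) • G.A)) *ᵥ x₀
    + (∫ τ in t₀..t, (G.C * NormedSpace.exp ((t - τ) • G.A) * G.B) *ᵥ w τ)
    + G.D *ᵥ w t

end LTI

/-! ### The event-triggered loop -/

/-- The data of the loop: nominal plant `(A, B, C, 0)`, controller, additive uncertainty, and
the parameters of the static triggering function. The plant output has dimension `p`, the
control has dimension `m`. -/
structure Loop (n nK nΔ p m : ℕ) where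
  A : Matrix (Fin n) (Fin n) ℝ
  B : Matrix (Fin n) (Fin m) ℝ
  C : Matrix (Fin p) (Fin n) ℝ
  K : LTI nK p m
  Δ : LTI nΔ m p
  Ω₁ : Matrix (Fin p) (Fin p) ℝ
  Ω₂ : Matrix (Fin m) (Fin m) ℝ
  μ : ℝ
  ν : ℝ

/-- The signals of the loop: triggering instants (`⊤` if there is no further one), states of
plant, controller and uncertainty, and the sampled outputs `ŷ` and `û`. -/
structure Traj (n nK nΔ p m : ℕ) where
  T : ℕ → EReal
  xp : Signal (Fin n)
  xk : Signal (Fin nK)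
  ξ : Signal (Fin nΔ)
  yh : Signal (Fin p)
  uh : Signal (Fin m)

/-- The sampled outputs `v = (ŷ, û)`. -/
def Traj.v {n nK nΔ p m : ℕ} (X : Traj n nK nΔ p m) : Signal (Fin p ⊕ Fin m) :=
  fun t => Sum.elim (X.yh t) (X.uh t)

namespace Loop

variable {n nK nΔ p m : ℕ}

/-- The nominal plant. -/
def plant (S : Loop n nK nΔ p m) : LTI n m p := ⟨S.A, S.B, S.C, 0⟩

/-- The triggering function `f = εᵀ ε - vᵀ diag(Ω₁, Ω₂) v - μ e^{-νt}`. -/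
def trigger (S : Loop n nK nΔ p m) (ε v : Fin p ⊕ Fin m → ℝ) (t : ℝ) : ℝ :=
  ε ⬝ᵥ ε - v ⬝ᵥ (fromBlocks S.Ω₁ 0 0 S.Ω₂ *ᵥ v) - S.μ * Real.exp (-S.ν * t)

/-- The output of the uncertainty when its state is `ξ` and its input is `û`. -/
def dOut (S : Loop n nK nΔ p m) (ξ : Fin nΔ → ℝ) (uh : Fin m → ℝ) : Fin p → ℝ :=
  S.Δ.C *ᵥ ξ + S.Δ.D *ᵥ uh

/-- The uncertainty output `d`. -/
def d (S : Loop n nK nΔ p m) (X : Traj n nK nΔ p m) : Signal (Fin p) := fun t =>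
  S.dOut (X.ξ t) (X.uh t)

/-- The actual plant output `y = C x_p + d`. -/
def y (S : Loop n nK nΔ p m) (X : Traj n nK nΔ p m) : Signal (Fin p) := fun t =>
  S.C *ᵥ X.xp t + S.d X t

/-- The actual controller output `u = C_k x_k + D_k ŷ`. -/
def u (S : Loop n nK nΔ p m) (X : Traj n nK nΔ p m) : Signal (Fin m) := fun t =>
  S.K.C *ᵥ X.xk t + S.K.D *ᵥ X.yh t

/-- The sampling error `ε = (ŷ - y, û - u)`. -/
def ε (S : Loop n nK nΔ p m) (X : Traj n nK nΔ p m) : Signal (Fin p ⊕ Fin m) := fun t =>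
  Sum.elim (X.yh t - S.y X t) (X.uh t - S.u X t)

/-- The pair `(ε, d)`. -/
def εd (S : Loop n nK nΔ p m) (X : Traj n nK nΔ p m) :
    Signal ((Fin p ⊕ Fin m) ⊕ Fin p) := fun t => Sum.elim (S.ε X t) (S.d X t)

/-- The sampling error at time `t`, as long as the samples taken at time `s` are still held. Up to
the next triggering instant it is `ε`; there it is the value of `ε` before the reset. -/
def heldError (S : Loop n nK nΔ p m) (X : Traj n nK nΔ p m) (s t : ℝ) :
    Fin p ⊕ Fin m → ℝ :=
  Sum.elim (X.yh s - (S.C *ᵥ X.xp t + S.dOut (X.ξ t) (X.uh s)))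
    (X.uh s - (S.K.C *ᵥ X.xk t + S.K.D *ᵥ X.yh s))

/-- `X` is a run of the event-triggered closed loop on `[0, ∞)`, without Zeno behaviour. The
signals `ŷ` and `û` are right continuous, so the state equations hold with right derivatives. -/
structure IsRun (S : Loop n nK nΔ p m) (X : Traj n nK nΔ p m) : Prop where
  /-- the first sampling takes place at time `0` -/
  start : X.T 0 = 0
  /-- the next triggering instant is the first later time at which `f ≥ 0` -/
  next : ∀ k, X.T (k + 1) = sInf ((fun t : ℝ => (t : EReal)) ''
    {t : ℝ | X.T k < (t : EReal) ∧
      0 ≤ S.trigger (S.heldError X (X.T k).toReal t) (X.v (X.T k).toReal) t})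
  /-- the intervals between triggering instants exhaust `[0, ∞)` -/
  cover : ∀ t : ℝ, 0 ≤ t → ∃ k, X.T k ≤ (t : EReal) ∧ (t : EReal) < X.T (k + 1)
  /-- `ŷ` and `û` are sampled at the triggering instants, and held in between -/
  sample : ∀ k (t : ℝ), X.T k ≤ (t : EReal) → (t : EReal) < X.T (k + 1) →
    X.yh t = S.y X (X.T k).toReal ∧ X.uh t = S.u X (X.T k).toReal
  xp_cont : ContinuousOn X.xp (Ici 0)
  xk_cont : ContinuousOn X.xk (Ici 0)
  ξ_cont : ContinuousOn X.ξ (Ici 0)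
  /-- the nominal plant is driven by `û` -/
  xp_deriv : ∀ t : ℝ, 0 ≤ t →
    HasDerivWithinAt X.xp (S.A *ᵥ X.xp t + S.B *ᵥ X.uh t) (Ici t) t
  /-- the controller is driven by `ŷ` -/
  xk_deriv : ∀ t : ℝ, 0 ≤ t →
    HasDerivWithinAt X.xk (S.K.A *ᵥ X.xk t + S.K.B *ᵥ X.yh t) (Ici t) t
  /-- the uncertainty is driven by `û`, from rest -/
  ξ_deriv : ∀ t : ℝ, 0 ≤ t →
    HasDerivWithinAt X.ξ (S.Δ.A *ᵥ X.ξ t + S.Δ.B *ᵥ X.uh t) (Ici t) t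
  ξ_zero : X.ξ 0 = 0

/-- The `ε`-part of the operator `Γ`, for initial states `x_p⁰` of the plant and `x_k⁰` of the
controller. -/
def Γε (S : Loop n nK nΔ p m) (xp₀ : Fin n → ℝ) (xk₀ : Fin nK → ℝ)
    (v : Signal (Fin p ⊕ Fin m)) : Signal (Fin p ⊕ Fin m) := fun t =>
  let yh : Signal (Fin p) := fun t i => v t (Sum.inl i)
  let uh : Signal (Fin m) := fun t i => v t (Sum.inr i)
  Sum.elim
    (yh t - S.plant.outputFrom 0 xp₀ uh t - S.Δ.outputFrom 0 0 uh t)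
    (uh t - S.K.outputFrom 0 xk₀ yh t)

/-- The operator `Γ` from `v = (ŷ, û)` to `(ε, d)`. -/
def Γ (S : Loop n nK nΔ p m) (xp₀ : Fin n → ℝ) (xk₀ : Fin nK → ℝ)
    (v : Signal (Fin p ⊕ Fin m)) : Signal ((Fin p ⊕ Fin m) ⊕ Fin p) := fun t =>
  Sum.elim (S.Γε xp₀ xk₀ v t) (S.Δ.outputFrom 0 0 (fun t i => v t (Sum.inr i)) t)

/-- The signals `v` that the triggering mechanism admits: the triggering function stays
nonpositive along `v` and the sampling error that `Γ` attaches to `v`. -/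
def admissible (S : Loop n nK nΔ p m) (xp₀ : Fin n → ℝ) (xk₀ : Fin nK → ℝ) :
    Set (Signal (Fin p ⊕ Fin m)) :=
  {v | ∀ᵐ t ∂(volume.restrict (Ici (0 : ℝ))), S.trigger (S.Γε xp₀ xk₀ v t) (v t) t ≤ 0}

/-- `γ = (max {ρ(Ω₁), ρ(Ω₂ + η² I)})^{1/2}`. -/
def gain (S : Loop n nK nΔ p m) (η : ℝ) : ℝ :=
  √(max (specRad S.Ω₁) (specRad (S.Ω₂ + η ^ 2 • (1 : Matrix (Fin m) (Fin m) ℝ))))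

end Loop

end

end ETC

namespace ETC

/-! ### Real and complex matrices -/

theorem cplx_mul {ι κ l : Type} [Fintype κ] (M : Matrix ι κ ℝ) (N : Matrix κ l ℝ) :
    cplx (M * N) = cplx M * cplx N := by
  ext i j
  simp [cplx, Matrix.mul_apply]

theorem cplx_mulVec {ι κ : Type} [Fintype κ] (M : Matrix ι κ ℝ) (x : κ → ℝ) :
    cplx M *ᵥ (fun i => (x i : ℂ)) = fun i => (((M *ᵥ x) i : ℝ) : ℂ) := by
  ext i
  simp [cplx, Matrix.mulVec, dotProduct]

theorem continuous_cplx {ι κ : Type} : Continuous (cplx : Matrix ι κ ℝ → Matrix ι κ ℂ) :=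
  continuous_id.matrix_map Complex.continuous_ofReal

theorem continuous_exp {𝕜 : Type} [RCLike 𝕜] {n : ℕ} :
    Continuous (NormedSpace.exp : Matrix (Fin n) (Fin n) 𝕜 → Matrix (Fin n) (Fin n) 𝕜) := by
  let +nondep : NormedAlgebra ℚ (Matrix (Fin n) (Fin n) 𝕜) := .restrictScalars ℚ 𝕜 _
  exact NormedSpace.exp_continuous

theorem cplx_exp {n : ℕ} (A : Matrix (Fin n) (Fin n) ℝ) (t : ℝ) :
    cplx (NormedSpace.exp (t • A)) = NormedSpace.exp ((t : ℂ) • cplx A) := by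
  let +nondep : NormedAlgebra ℚ (Matrix (Fin n) (Fin n) ℝ) := .restrictScalars ℚ ℝ _
  have h := NormedSpace.map_exp (f := (Complex.ofRealHom.mapMatrix :
    Matrix (Fin n) (Fin n) ℝ →+* Matrix (Fin n) (Fin n) ℂ)) continuous_cplx (t • A)
  have e : Complex.ofRealHom.mapMatrix (t • A) = (t : ℂ) • cplx A := by
    ext i j; simp [cplx]
  rw [e] at h
  exact h

/-- A real vector as a complex Euclidean vector. -/
noncomputable def cvec {ι : Type} (x : ι → ℝ) : EuclideanSpace ℂ ι :=
  WithLp.toLp 2 fun i => (x i : ℂ)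

theorem norm_sq_toLp {ι : Type} [Fintype ι] (x : ι → ℝ) :
    ‖(WithLp.toLp 2 x : EuclideanSpace ℝ ι)‖ ^ 2 = x ⬝ᵥ x := by
  simp [EuclideanSpace.norm_sq_eq, dotProduct, ← sq]

theorem norm_cvec {ι : Type} [Fintype ι] (x : ι → ℝ) :
    ‖cvec x‖ = ‖(WithLp.toLp 2 x : EuclideanSpace ℝ ι)‖ := by
  simp [cvec, EuclideanSpace.norm_eq]

theorem cvec_mulVec {ι κ : Type} [Fintype κ] (M : Matrix ι κ ℝ) (x : κ → ℝ) :
    cvec (M *ᵥ x) = WithLp.toLp 2 (cplx M *ᵥ (WithLp.ofLp (cvec x))) := by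
  simp [cvec, cplx_mulVec]

theorem norm_cvec_mulVec_le {ι κ : Type} [Fintype ι] [Fintype κ] [DecidableEq κ]
    (M : Matrix ι κ ℝ) (x : κ → ℝ) :
    ‖cvec (M *ᵥ x)‖ ≤ ‖cplx M‖ * ‖cvec x‖ := by
  rw [cvec_mulVec]
  exact Matrix.l2_opNorm_mulVec (cplx M) (cvec x)

/-- The complexified matrix is self-adjoint, and in a C⋆-algebra the spectral radius of such an
element is its norm. -/
theorem specRad_eq_norm {n : ℕ} {M : Matrix (Fin n) (Fin n) ℝ} (hM : M.IsHermitian) :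
    specRad M = ‖cplx M‖ := by
  have h : IsSelfAdjoint (cplx M) := by
    change (cplx M)ᴴ = cplx M
    have hM' : Mᵀ = M := by simpa [IsHermitian, conjTranspose_eq_transpose_of_trivial] using hM
    ext i j
    have := congrFun (congrFun hM' i) j
    simp only [transpose_apply] at this
    simp [cplx, this]
  exact h.toReal_spectralRadius_complex_eq_norm

theorem dotProduct_mulVec_le {n : ℕ} {M : Matrix (Fin n) (Fin n) ℝ} (hM : M.IsHermitian)
    (x : Fin n → ℝ) : x ⬝ᵥ (M *ᵥ x) ≤ specRad M * (x ⬝ᵥ x) := by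
  have h1 := real_inner_le_norm (WithLp.toLp 2 (M *ᵥ x) : EuclideanSpace ℝ (Fin n))
    (WithLp.toLp 2 x)
  rw [EuclideanSpace.inner_eq_star_dotProduct] at h1
  have h2 := norm_cvec_mulVec_le M x
  rw [norm_cvec, norm_cvec, ← specRad_eq_norm hM] at h2
  simp only [star_trivial] at h1
  calc _ ≤ _ := h1
    _ ≤ specRad M * ‖(WithLp.toLp 2 x : EuclideanSpace ℝ (Fin n))‖ * ‖(WithLp.toLp 2 x : EuclideanSpace ℝ (Fin n))‖ := by gcongr
    _ = _ := by rw [← norm_sq_toLp]; ring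

theorem specRad_nonneg {n : ℕ} (M : Matrix (Fin n) (Fin n) ℝ) : 0 ≤ specRad M :=
  ENNReal.toReal_nonneg

theorem specRad_pos {n : ℕ} {M : Matrix (Fin n) (Fin n) ℝ} (hM : M.PosDef) (hn : 0 < n) :
    0 < specRad M := by
  rw [specRad_eq_norm hM.1, norm_pos_iff]
  intro h
  have : 0 < M ⟨0, hn⟩ ⟨0, hn⟩ := hM.diag_pos
  have h2 := congrFun (congrFun h ⟨0, hn⟩) ⟨0, hn⟩
  simp [cplx] at h2
  linarith

/-! ### Spectral mapping and decay of the matrix exponential -/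

theorem exp_mulVec_of_eigenvector {n : ℕ} {A : Matrix (Fin n) (Fin n) ℂ} {z : ℂ} {v : Fin n → ℂ}
    (hv : A *ᵥ v = z • v) : NormedSpace.exp A *ᵥ v = Complex.exp z • v := by
  have h1 := NormedSpace.exp_series_hasSum_exp' (𝕂 := ℂ) A
  have h2 := h1.map (⟨⟨fun M => M *ᵥ v, Matrix.zero_mulVec v⟩, fun M N => Matrix.add_mulVec M N v⟩ :
    Matrix (Fin n) (Fin n) ℂ →+ (Fin n → ℂ)) (by
      change Continuous fun M : Matrix (Fin n) (Fin n) ℂ => M *ᵥ v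
      exact continuous_id.matrix_mulVec continuous_const)
  have h3 := (NormedSpace.exp_series_hasSum_exp' (𝕂 := ℂ) z).smul_const v
  rw [← Complex.exp_eq_exp_ℂ] at h3
  refine h2.unique ?_
  convert h3 using 2 with k
  have : ∀ k : ℕ, A ^ k *ᵥ v = z ^ k • v := by
    intro k
    induction k with
    | zero => simp
    | succ k ih => rw [pow_succ', ← Matrix.mulVec_mulVec, ih, Matrix.mulVec_smul, hv, smul_smul, pow_succ]
  simp [this, Matrix.smul_mulVec, smul_smul]

/-- `A` commutes with `exp A`, so it preserves the eigenspace of `exp A` for `w`. Over `ℂ` it has an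
eigenvector there, and its eigenvalue `z` must satisfy `exp z = w`. -/
theorem exists_mem_spectrum_of_mem_spectrum_exp {n : ℕ} {A : Matrix (Fin n) (Fin n) ℂ} {w : ℂ}
    (hw : w ∈ spectrum ℂ (NormedSpace.exp A)) : ∃ z ∈ spectrum ℂ A, Complex.exp z = w := by
  rw [← Matrix.spectrum_toLin', ← Module.End.hasEigenvalue_iff_mem_spectrum] at hw
  set E := Module.End.eigenspace (Matrix.toLin' (NormedSpace.exp A)) w
  have hE : Nontrivial E := Submodule.nontrivial_iff_ne_bot.2 hw
  have hcomm : Commute (Matrix.toLin' A) (Matrix.toLin' (NormedSpace.exp A)) := by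
    have := (Commute.refl A).exp_right
    change _ * _ = _ * _
    rw [Module.End.mul_eq_comp, Module.End.mul_eq_comp, ← Matrix.toLin'_mul, ← Matrix.toLin'_mul,
      this.eq]
  have hmaps : MapsTo (Matrix.toLin' A) E E :=
    Module.End.mapsTo_genEigenspace_of_comm hcomm.symm w 1
  obtain ⟨z, hz⟩ := Module.End.exists_eigenvalue ((Matrix.toLin' A).restrict hmaps)
  obtain ⟨v, hv⟩ := hz.exists_hasEigenvector
  have h0 : (v : Fin n → ℂ) ≠ 0 := by simpa using hv.2
  have h1 : A *ᵥ (v : Fin n → ℂ) = z • (v : Fin n → ℂ) := by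
    exact congrArg Subtype.val hv.apply_eq_smul
  refine ⟨z, ?_, ?_⟩
  · rw [← Matrix.spectrum_toLin', ← Module.End.hasEigenvalue_iff_mem_spectrum]
    exact Module.End.hasEigenvalue_of_hasEigenvector
      (x := (v : Fin n → ℂ)) ⟨Module.End.mem_eigenspace_iff.2 (by simpa using h1), h0⟩
  · have h2 := exp_mulVec_of_eigenvector h1
    have h3 : NormedSpace.exp A *ᵥ (v : Fin n → ℂ) = w • (v : Fin n → ℂ) := by
      simpa using Module.End.mem_eigenspace_iff.1 v.2
    rw [h2] at h3
    exact smul_left_injective ℂ h0 h3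

theorem spectralRadius_exp_lt_one {n : ℕ} {A : Matrix (Fin n) (Fin n) ℂ}
    (hA : ∀ z ∈ spectrum ℂ A, z.re < 0) : spectralRadius ℂ (NormedSpace.exp A) < 1 := by
  -- The spectrum is empty when `n = 0`; the strict bound on a supremum otherwise needs a nonempty
  -- spectrum.
  rcases (spectrum ℂ (NormedSpace.exp A)).eq_empty_or_nonempty with h | h
  · simp [spectralRadius, h]
  · refine spectrum.spectralRadius_lt_of_forall_lt_of_nonempty h (r := 1) fun w hw => ?_
    obtain ⟨z, hz, rfl⟩ := exists_mem_spectrum_of_mem_spectrum_exp hw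
    rw [← NNReal.coe_lt_coe]
    simpa [Complex.norm_exp] using hA z hz

/-- The matrix exponential of a Hurwitz matrix decays exponentially. -/
theorem exists_norm_exp_le {n : ℕ} {A : Matrix (Fin n) (Fin n) ℂ}
    (hA : ∀ z ∈ spectrum ℂ A, z.re < 0) :
    ∃ K > 0, ∃ α > 0, ∀ t : ℝ, 0 ≤ t →
      ‖NormedSpace.exp ((t : ℂ) • A)‖ ≤ K * Real.exp (-α * t) := by
  obtain ⟨r, hr0, hr1⟩ := exists_between (spectralRadius_exp_lt_one hA)
  lift r to NNReal using hr1.ne_top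
  have hr1' : (r : ℝ) < 1 := by exact_mod_cast hr1
  have hr0' : (0 : ℝ) < r := by
    have : (0 : ENNReal) < r := lt_of_le_of_lt zero_le hr0
    exact_mod_cast this
  -- Gelfand's formula: eventually `‖(exp A)^k‖ ≤ r^k`, for an `r < 1` strictly above the spectral
  -- radius.
  have hev := (spectrum.pow_norm_pow_one_div_tendsto_nhds_spectralRadius
    (NormedSpace.exp A)).eventually (gt_mem_nhds hr0)
  obtain ⟨N, hN⟩ := Filter.eventually_atTop.1 hev
  have hN' : ∀ k ≥ N + 1, ‖NormedSpace.exp A ^ k‖ ≤ (r : ℝ) ^ k := by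
    intro k hk
    have h1 := hN k (by omega)
    have hk0 : (k : ℝ) ≠ 0 := by
      have : k ≠ 0 := by omega
      exact_mod_cast this
    have h2 : ‖NormedSpace.exp A ^ k‖ ^ (1 / (k : ℝ)) ≤ r := by
      rw [← ENNReal.ofReal_coe_nnreal, ENNReal.ofReal_lt_ofReal_iff hr0'] at h1
      exact h1.le
    calc ‖NormedSpace.exp A ^ k‖ = (‖NormedSpace.exp A ^ k‖ ^ (1 / (k : ℝ))) ^ k := by
          rw [← Real.rpow_natCast, ← Real.rpow_mul (norm_nonneg _), one_div_mul_cancel hk0,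
            Real.rpow_one]
      _ ≤ _ := by gcongr
  have hcont : Continuous fun t : ℝ => NormedSpace.exp ((t : ℂ) • A) :=
    continuous_exp.comp (by fun_prop)
  obtain ⟨K₁, hK₁⟩ := (isCompact_Icc (a := (0 : ℝ)) (b := 1)).exists_bound_of_continuousOn
    hcont.continuousOn
  obtain ⟨K₂, hK₂⟩ := (isCompact_Icc (a := (0 : ℝ)) (b := N + 1)).exists_bound_of_continuousOn
    hcont.continuousOn
  have hK₁0 : 0 ≤ K₁ := (norm_nonneg _).trans (hK₁ 0 (by simp))
  have hK₂0 : 0 ≤ K₂ := (norm_nonneg _).trans (hK₂ 0 ⟨le_rfl, by positivity⟩)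
  set α := -Real.log r with hα
  have hα0 : 0 < α := by have := Real.log_neg hr0' hr1'; linarith
  have hrexp : ∀ k : ℕ, (r : ℝ) ^ k = Real.exp (-α * k) := by
    intro k
    rw [hα, neg_neg, mul_comm, Real.exp_nat_mul, Real.exp_log hr0']
  -- The rate comes from `r = e^{-α}`. The `K₂` term covers `t ≤ N + 1` by compactness. The `K₁`
  -- term covers larger `t`, split as `⌊t⌋` plus a remainder in `[0, 1]`, which costs a factor
  -- `e^α`. The `1` ensures positivity.
  refine ⟨K₁ * Real.exp α + K₂ * Real.exp (α * (N + 1)) + 1, by positivity, α, hα0, fun t ht => ?_⟩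
  rcases le_or_gt t (N + 1) with h | h
  · calc ‖NormedSpace.exp ((t : ℂ) • A)‖ ≤ K₂ := hK₂ t ⟨ht, h⟩
      _ ≤ K₂ * Real.exp (α * (N + 1)) * Real.exp (-α * t) := by
        rw [mul_assoc, ← Real.exp_add]
        refine le_mul_of_one_le_right hK₂0 (Real.one_le_exp ?_)
        nlinarith
      _ ≤ _ := by
        gcongr
        have : 0 ≤ K₁ * Real.exp α := by positivity
        linarith
  · set k := ⌊t⌋₊
    have hk1 : (k : ℝ) ≤ t := Nat.floor_le ht
    have hk2 : t < k + 1 := Nat.lt_floor_add_one t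
    have hk3 : N + 1 ≤ k := Nat.le_floor (by push_cast; exact h.le)
    have e : NormedSpace.exp ((t : ℂ) • A)
        = NormedSpace.exp (((t - k : ℝ) : ℂ) • A) * NormedSpace.exp A ^ k := by
      rw [← Matrix.exp_nsmul, ← Matrix.exp_add_of_commute]
      · congr 1
        rw [← Nat.cast_smul_eq_nsmul ℂ, ← add_smul]
        push_cast
        congr 1
        ring
      · exact ((Commute.refl A).smul_left _).smul_right _
    calc ‖NormedSpace.exp ((t : ℂ) • A)‖
        ≤ ‖NormedSpace.exp (((t - k : ℝ) : ℂ) • A)‖ * ‖NormedSpace.exp A ^ k‖ := by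
          rw [e]; exact norm_mul_le _ _
      _ ≤ K₁ * Real.exp (-α * k) := by
          rw [← hrexp]
          gcongr
          · exact hK₁ _ ⟨by linarith, by linarith⟩
          · exact hN' k hk3
      _ ≤ K₁ * Real.exp α * Real.exp (-α * t) := by
          rw [mul_assoc, ← Real.exp_add]
          gcongr
          nlinarith
      _ ≤ _ := by
        gcongr
        have : 0 ≤ K₂ * Real.exp (α * (N + 1)) := by positivity
        linarith

open scoped FourierTransform

/-! ### The Fourier transform of square integrable functions -/

section Fourier

variable {F : Type*} [NormedAddCommGroup F] [InnerProductSpace ℂ F]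

theorem continuous_fourier {f : ℝ → F} (hf : Integrable f) : Continuous (𝓕 f) :=
  VectorFourier.fourierIntegral_continuous Real.continuous_fourierChar
    (by exact continuous_inner) hf

variable [CompleteSpace F]

open scoped SchwartzMap ContDiff in
/-- The `L²` Fourier transform of an integrable function is its Fourier integral. -/
theorem fourier_toLp_ae_eq {f : ℝ → F} (hf : Integrable f) (hf2 : MemLp f 2) :
    (𝓕 (hf2.toLp f) : Lp F 2 (volume : Measure ℝ)) =ᵐ[volume] 𝓕 f := by
  -- Both sides are tested against smooth compactly supported functions. The `L²` transform agrees
  -- with the distributional one, and Fubini moves the transform from the test function to `f`.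
  refine ae_eq_of_integral_contDiff_smul_eq ((Lp.memLp _).locallyIntegrable (by norm_num))
    (continuous_fourier hf).locallyIntegrable fun g hg hgs => ?_
  have hg' : ContDiff ℝ ∞ fun x => (g x : ℂ) := Complex.ofRealCLM.contDiff.comp hg
  have hgs' : HasCompactSupport fun x => (g x : ℂ) := hgs.comp_left (g := fun x : ℝ => (x : ℂ)) rfl
  set φ : 𝓢(ℝ, ℂ) := hgs'.toSchwartzMap hg' with hφ
  have hφg : ∀ x, φ x = (g x : ℂ) := fun x => rfl
  have h1 := congrArg (fun T => T φ) (Lp.fourier_toTemperedDistribution_eq (hf2.toLp f))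
  simp only [TemperedDistribution.fourier_apply, Lp.toTemperedDistribution_apply] at h1
  have h2 : ∫ x, (𝓕 φ) x • (hf2.toLp f) x = ∫ x, (𝓕 φ) x • f x :=
    integral_congr_ae (by filter_upwards [hf2.coeFn_toLp] with x hx; rw [hx])
  have h3 : ∫ x, (𝓕 (φ : ℝ → ℂ)) x • f x = ∫ x, φ x • 𝓕 f x := by
    simpa using! (VectorFourier.integral_fourierIntegral_smul_eq_flip (L := innerₗ ℝ)
      Real.continuous_fourierChar continuous_inner φ.integrable hf)
  rw [h2, SchwartzMap.fourier_coe, h3] at h1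
  simpa [hφg] using h1.symm

theorem eLpNorm_fourier_eq {f : ℝ → F} (hf : Integrable f) (hf2 : MemLp f 2) :
    eLpNorm (𝓕 f) 2 volume = eLpNorm f 2 volume := by
  rw [← eLpNorm_congr_ae (fourier_toLp_ae_eq hf hf2), ← eLpNorm_congr_ae hf2.coeFn_toLp,
    ← Lp.enorm_def, ← Lp.enorm_def, ← ofReal_norm, ← ofReal_norm, Lp.norm_fourier_eq]

theorem eLpNorm_le_of_fourier_le {G : Type*} [NormedAddCommGroup G] [InnerProductSpace ℂ G]
    [CompleteSpace G] {f : ℝ → F} {g : ℝ → G} (hf : Integrable f) (hf2 : MemLp f 2)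
    (hg : Integrable g) (hg2 : MemLp g 2) {c : ℝ} (h : ∀ ξ, ‖𝓕 g ξ‖ ≤ c * ‖𝓕 f ξ‖) :
    eLpNorm g 2 volume ≤ ENNReal.ofReal c * eLpNorm f 2 volume := by
  rw [← eLpNorm_fourier_eq hf hf2, ← eLpNorm_fourier_eq hg hg2]
  exact eLpNorm_le_mul_eLpNorm_of_ae_le_mul (Filter.Eventually.of_forall h) 2

end Fourier

/-! ### The Fourier transform of the matrix exponential -/

/-- Matrix-vector multiplication on complex Euclidean spaces. -/
noncomputable def mulVecCLM (o i : ℕ) : Matrix (Fin o) (Fin i) ℂ →L[ℂ]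
    EuclideanSpace ℂ (Fin i) →L[ℂ] EuclideanSpace ℂ (Fin o) :=
  LinearMap.mkContinuous₂
    (LinearMap.mk₂ ℂ (fun (M : Matrix (Fin o) (Fin i) ℂ) (x : EuclideanSpace ℂ (Fin i)) =>
      (WithLp.toLp 2 (M *ᵥ x.ofLp) : EuclideanSpace ℂ (Fin o)))
      (fun M N x => by ext; simp [Matrix.add_mulVec])
      (fun c M x => by ext; simp [Matrix.smul_mulVec])
      (fun M x y => by ext; simp [Matrix.mulVec_add])
      (fun c M x => by ext; simp [Matrix.mulVec_smul])) 1
    fun M x => by simpa using Matrix.l2_opNorm_mulVec M x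

theorem mulVecCLM_apply {o i : ℕ} (M : Matrix (Fin o) (Fin i) ℂ) (x : EuclideanSpace ℂ (Fin i)) :
    mulVecCLM o i M x = WithLp.toLp 2 (M *ᵥ x.ofLp) := rfl

theorem norm_mulVecCLM_le {o i : ℕ} (M : Matrix (Fin o) (Fin i) ℂ)
    (x : EuclideanSpace ℂ (Fin i)) : ‖mulVecCLM o i M x‖ ≤ ‖M‖ * ‖x‖ :=
  Matrix.l2_opNorm_mulVec M x

theorem mulVecCLM_mul {o l i : ℕ} (M : Matrix (Fin o) (Fin l) ℂ) (N : Matrix (Fin l) (Fin i) ℂ)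
    (x : EuclideanSpace ℂ (Fin i)) :
    mulVecCLM o i (M * N) x = mulVecCLM o l M (mulVecCLM l i N x) := by
  simp [mulVecCLM_apply, Matrix.mulVec_mulVec]

theorem continuous_exp_smul {𝕜 : Type} [RCLike 𝕜] {n : ℕ} (A : Matrix (Fin n) (Fin n) 𝕜) :
    Continuous fun t : ℝ => NormedSpace.exp ((t : 𝕜) • A) :=
  continuous_exp.comp (by fun_prop)

theorem hasDerivAt_exp_smul {n : ℕ} (A : Matrix (Fin n) (Fin n) ℂ) (t : ℝ) :
    HasDerivAt (fun t : ℝ => NormedSpace.exp ((t : ℂ) • A)) (A * NormedSpace.exp ((t : ℂ) • A)) t := by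
  have h := (hasDerivAt_exp_smul_const' (𝕂 := ℂ) A (t : ℂ)).scomp t Complex.ofRealCLM.hasDerivAt
  rw [Complex.ofRealCLM_apply, Complex.ofReal_one, one_smul] at h
  exact h

section Kernel

variable {n : ℕ} {A : Matrix (Fin n) (Fin n) ℂ}

/-- The impulse response `t ↦ exp (t A)`, `t ≥ 0`. -/
noncomputable def expKernel (A : Matrix (Fin n) (Fin n) ℂ) : ℝ → Matrix (Fin n) (Fin n) ℂ :=
  (Ici (0 : ℝ)).indicator fun t => NormedSpace.exp ((t : ℂ) • A)

theorem exists_norm_expKernel_le (hA : ∀ z ∈ spectrum ℂ A, z.re < 0) :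
    ∃ K, ∀ t, ‖expKernel A t‖ ≤ K := by
  obtain ⟨K, hK, α, hα, h⟩ := exists_norm_exp_le hA
  refine ⟨K, fun t => ?_⟩
  by_cases ht : t ∈ Ici (0 : ℝ)
  · rw [expKernel, indicator_of_mem ht]
    refine (h t ht).trans (mul_le_of_le_one_right hK.le (Real.exp_le_one_iff.2 ?_))
    have : 0 ≤ t := ht
    nlinarith
  · rw [expKernel, indicator_of_notMem ht, norm_zero]
    exact hK.le

theorem integrableOn_exp (hA : ∀ z ∈ spectrum ℂ A, z.re < 0) :
    IntegrableOn (fun t : ℝ => NormedSpace.exp ((t : ℂ) • A)) (Ici 0) := by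
  obtain ⟨K, hK, α, hα, h⟩ := exists_norm_exp_le hA
  have h1 : IntegrableOn (fun t : ℝ => K * Real.exp (-α * t)) (Ici 0) :=
    ((integrableOn_Ici_iff_integrableOn_Ioi).2 (exp_neg_integrableOn_Ioi 0 hα)).const_mul K
  refine h1.mono' (continuous_exp_smul A).aestronglyMeasurable ?_
  filter_upwards [ae_restrict_mem measurableSet_Ici] with t ht using h t ht

theorem integrable_expKernel (hA : ∀ z ∈ spectrum ℂ A, z.re < 0) : Integrable (expKernel A) :=
  (integrable_indicator_iff measurableSet_Ici).2 (integrableOn_exp hA)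

/-- With `s = 2πiξ`, the integrand `g(t) = e^{-st} e^{tA}` satisfies `g' = (A - s) g`, starts at `1`
and tends to `0`. Integrating over the half line gives `(s - A) ∫ g = 1`. -/
theorem fourier_expKernel (hA : ∀ z ∈ spectrum ℂ A, z.re < 0) (ξ : ℝ) :
    𝓕 (expKernel A) ξ
      = ((Complex.I * ((2 * Real.pi * ξ : ℝ) : ℂ)) • (1 : Matrix (Fin n) (Fin n) ℂ) - A)⁻¹ := by
  set s : ℂ := Complex.I * ((2 * Real.pi * ξ : ℝ) : ℂ) with hs
  have hsre : s.re = 0 := by simp [hs]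
  set g : ℝ → Matrix (Fin n) (Fin n) ℂ := fun t =>
    Complex.exp (-s * t) • NormedSpace.exp ((t : ℂ) • A) with hg
  have h1 : 𝓕 (expKernel A) ξ = ∫ t in Ioi (0 : ℝ), g t := by
    rw [Real.fourier_eq, ← integral_Ici_eq_integral_Ioi, ← integral_indicator measurableSet_Ici]
    congr 1 with t : 1
    by_cases ht : t ∈ Ici (0 : ℝ)
    · rw [expKernel, indicator_of_mem ht, indicator_of_mem ht, hg, Circle.smul_def,
        Real.fourierChar_apply]
      congr 2
      simp [hs]
      ring
    · rw [expKernel, indicator_of_notMem ht, indicator_of_notMem ht, smul_zero]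
  have hnorm : ∀ t : ℝ, ‖g t‖ = ‖NormedSpace.exp ((t : ℂ) • A)‖ := by
    intro t
    rw [hg, norm_smul, Complex.norm_exp]
    simp [hsre]
  have hgc : Continuous g := by
    have := continuous_exp_smul A
    rw [hg]
    exact (by fun_prop : Continuous fun t : ℝ => Complex.exp (-s * t)).smul this
  have hgi : IntegrableOn g (Ioi 0) := by
    have := (integrableOn_exp hA).mono_set Ioi_subset_Ici_self
    exact Integrable.mono this hgc.aestronglyMeasurable (Filter.Eventually.of_forall fun t => (hnorm t).le)
  have hd : ∀ t : ℝ, HasDerivAt g ((A - s • (1 : Matrix (Fin n) (Fin n) ℂ)) * g t) t := by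
    intro t
    have h2 : HasDerivAt (fun t : ℝ => Complex.exp (-s * t)) (Complex.exp (-s * t) * (-s)) t := by
      have : HasDerivAt (fun t : ℝ => -s * (t : ℂ)) (-s) t := by
        simpa using (Complex.ofRealCLM.hasDerivAt (x := t)).const_mul (-s)
      exact this.cexp
    have h3 := h2.smul (hasDerivAt_exp_smul A t)
    have e : (A - s • (1 : Matrix (Fin n) (Fin n) ℂ)) * g t
        = Complex.exp (-s * t) • (A * NormedSpace.exp ((t : ℂ) • A))
          + (Complex.exp (-s * t) * (-s)) • NormedSpace.exp ((t : ℂ) • A) := by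
      simp only [hg, sub_mul, mul_smul_comm, smul_mul_assoc, one_mul]
      rw [smul_sub, smul_smul, mul_neg, neg_smul, sub_eq_add_neg]
    rw [e]
    exact h3
  have hlim : Filter.Tendsto g Filter.atTop (nhds 0) := by
    obtain ⟨K, hK, α, hα, h⟩ := exists_norm_exp_le hA
    refine squeeze_zero_norm' (a := fun t => K * Real.exp (-α * t)) ?_ ?_
    · filter_upwards [Filter.eventually_ge_atTop 0] with t ht
      rw [hnorm]
      exact h t ht
    · have : Filter.Tendsto (fun t : ℝ => -α * t) Filter.atTop Filter.atBot :=
        Filter.tendsto_id.const_mul_atTop_of_neg (by linarith)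
      simpa using (Real.tendsto_exp_atBot.comp this).const_mul K
  have hL : IntegrableOn (fun t => (A - s • (1 : Matrix (Fin n) (Fin n) ℂ)) * g t) (Ioi 0) :=
    hgi.const_mul _
  have h3 := integral_Ioi_of_hasDerivAt_of_tendsto (hgc.continuousWithinAt) (fun t _ => hd t) hL hlim
  rw [integral_const_mul_of_integrable hgi] at h3
  have h0 : g 0 = 1 := by simp [hg]
  rw [h0] at h3
  rw [h1]
  symm
  -- Invertibility of `s - A` need not be known beforehand: the integral itself is a right inverse.
  apply Matrix.inv_eq_right_inv
  rw [← neg_sub, neg_mul, h3]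
  simp

end Kernel

/-! ### Square integrable signals -/

theorem Ici_zero_eq_iUnion_Icc : Ici (0 : ℝ) = ⋃ k : ℕ, Icc (0 : ℝ) k := by
  ext t
  simp only [mem_Ici, mem_iUnion, mem_Icc, exists_and_left, iff_self_and]
  exact fun _ => exists_nat_ge t

section Signals

variable {ι κ : Type} [Fintype ι] [Fintype κ]

theorem memL2_iff {f : Signal ι} :
    MemL2 f ↔ ∀ i, MemLp (fun t => f t i) 2 (volume.restrict (Ici (0 : ℝ))) :=
  memLp_piLp_iff

theorem memL2Loc_iff {f : Signal ι} :
    MemL2Loc f ↔ ∀ i (T : ℝ), MemLp (fun t => f t i) 2 (volume.restrict (Icc (0 : ℝ) T)) := by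
  unfold MemL2Loc
  rw [forall_comm]
  exact forall_congr' fun T => memLp_piLp_iff

theorem MemL2.memL2Loc {f : Signal ι} (hf : MemL2 f) : MemL2Loc f := fun _ =>
  hf.mono_measure (Measure.restrict_mono Icc_subset_Ici_self le_rfl)

theorem MemL2Loc.aestronglyMeasurable {f : Signal ι} (hf : MemL2Loc f) :
    AEStronglyMeasurable (fun t => (WithLp.toLp 2 (f t) : EuclideanSpace ℝ ι))
      (volume.restrict (Ici (0 : ℝ))) := by
  rw [Ici_zero_eq_iUnion_Icc, aestronglyMeasurable_iUnion_iff]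
  exact fun k => (hf k).1

theorem MemL2Loc.integrableOn {f : Signal ι} (hf : MemL2Loc f) (T : ℝ) :
    IntegrableOn f (Icc 0 T) := by
  refine integrable_pi_iff.2 fun i => ?_
  exact (memL2Loc_iff.1 hf i T).integrable one_le_two

theorem MemL2Loc.add {f g : Signal ι} (hf : MemL2Loc f) (hg : MemL2Loc g) :
    MemL2Loc (fun t => f t + g t) := fun T => (hf T).add (hg T)

theorem MemL2Loc.sub {f g : Signal ι} (hf : MemL2Loc f) (hg : MemL2Loc g) :
    MemL2Loc (fun t => f t - g t) := fun T => (hf T).sub (hg T)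

theorem MemL2Loc.mulVec {f : Signal κ} (hf : MemL2Loc f) (M : Matrix ι κ ℝ) :
    MemL2Loc (fun t => M *ᵥ f t) := by
  refine memL2Loc_iff.2 fun i T => ?_
  exact memLp_finsetSum _ fun j _ => (memL2Loc_iff.1 hf j T).const_mul (M i j)

theorem memL2Loc_of_continuousOn {f : Signal ι} (hf : ContinuousOn f (Ici 0)) : MemL2Loc f := by
  refine memL2Loc_iff.2 fun i T => ?_
  have h : ContinuousOn (fun t => f t i) (Icc 0 T) :=
    ((continuous_apply i).comp_continuousOn hf).mono Icc_subset_Ici_self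
  obtain ⟨K, hK⟩ := isCompact_Icc.exists_bound_of_continuousOn h
  exact MemLp.of_bound (h.aestronglyMeasurable measurableSet_Icc) K
    (ae_restrict_of_forall_mem measurableSet_Icc hK)

theorem MemL2Loc.congr {f g : Signal ι} (hf : MemL2Loc f) (h : ∀ t, 0 ≤ t → f t = g t) :
    MemL2Loc g := fun T =>
  (memLp_congr_ae (by
    filter_upwards [ae_restrict_mem measurableSet_Icc] with t ht
    rw [h t ht.1])).1 (hf T)

theorem memL2Loc_elim {f : Signal ι} {g : Signal κ} (hf : MemL2Loc f) (hg : MemL2Loc g) :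
    MemL2Loc (fun t => Sum.elim (f t) (g t)) :=
  memL2Loc_iff.2 fun i T => by
    rcases i with i | i
    · exact memL2Loc_iff.1 hf i T
    · exact memL2Loc_iff.1 hg i T

theorem MemL2Loc.inl {v : Signal (ι ⊕ κ)} (hv : MemL2Loc v) :
    MemL2Loc (fun t i => v t (Sum.inl i)) :=
  memL2Loc_iff.2 fun i => memL2Loc_iff.1 hv (Sum.inl i)

theorem MemL2Loc.inr {v : Signal (ι ⊕ κ)} (hv : MemL2Loc v) :
    MemL2Loc (fun t i => v t (Sum.inr i)) :=
  memL2Loc_iff.2 fun i => memL2Loc_iff.1 hv (Sum.inr i)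

theorem MemL2.inr {v : Signal (ι ⊕ κ)} (hv : MemL2 v) : MemL2 (fun t i => v t (Sum.inr i)) :=
  memL2_iff.2 fun i => memL2_iff.1 hv (Sum.inr i)

theorem MemL2.integrable_dotProduct {f : Signal ι} (hf : MemL2 f) :
    IntegrableOn (fun t => f t ⬝ᵥ f t) (Ici (0 : ℝ)) := by
  have := (memLp_two_iff_integrable_sq_norm hf.1).1 hf
  simpa only [norm_sq_toLp, IntegrableOn] using this

theorem energy_eq {f : Signal ι} (hf : MemL2 f) : energy f =
    (eLpNorm (fun t => (WithLp.toLp 2 (f t) : EuclideanSpace ℝ ι)) 2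
      (volume.restrict (Ici (0 : ℝ)))).toReal ^ 2 := by
  have h0 : 0 ≤ energy f := integral_nonneg fun t => by
    rw [← norm_sq_toLp]; positivity
  rw [hf.eLpNorm_eq_integral_rpow_norm (by norm_num) (by norm_num)]
  have : (∫ t in Ici (0 : ℝ), ‖(WithLp.toLp 2 (f t) : EuclideanSpace ℝ ι)‖ ^ (2 : ENNReal).toReal)
      = energy f := by
    simp [energy, ← norm_sq_toLp]
  rw [this, ENNReal.toReal_ofReal (by positivity), ENNReal.toReal_ofNat, ← Real.rpow_natCast,
    ← Real.rpow_mul h0]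
  norm_num

end Signals

/-! ### Convolution integrals -/

theorem exp_sub_smul {n : ℕ} (A : Matrix (Fin n) (Fin n) ℝ) (s t : ℝ) :
    NormedSpace.exp ((t - s) • A) = NormedSpace.exp (t • A) * NormedSpace.exp (-s • A) := by
  rw [← Matrix.exp_add_of_commute _ _ (((Commute.refl A).smul_left _).smul_right _), ← add_smul,
    sub_eq_add_neg]

theorem continuousOn_mulVec {ι κ : Type} [Fintype κ] {K : ℝ → Matrix ι κ ℝ}
    {x : Signal κ} {s : Set ℝ} (hK : Continuous K) (hx : ContinuousOn x s) :
    ContinuousOn (fun t => K t *ᵥ x t) s := by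
  rw [continuousOn_iff_continuous_domRestrict] at hx ⊢
  exact (hK.comp continuous_subtype_val).matrix_mulVec hx

theorem integrableOn_mulVec {ι κ : Type} [Fintype ι] [Fintype κ] {K : ℝ → Matrix ι κ ℝ}
    (hK : Continuous K) {w : Signal κ} {a b : ℝ} (hw : IntegrableOn w (Icc a b)) :
    IntegrableOn (fun τ => K τ *ᵥ w τ) (Icc a b) := by
  refine integrable_pi_iff.2 fun i => ?_
  refine integrable_finsetSum _ fun j _ => ?_
  exact IntegrableOn.continuousOn_mul (hK.matrix_elem i j).continuousOn
    (integrable_pi_iff.1 hw j) isCompact_Icc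

theorem intervalIntegral_mulVec {ι κ : Type} [Fintype ι] [Fintype κ] (M : Matrix ι κ ℝ)
    {f : Signal κ} {a b : ℝ} (hf : IntervalIntegrable f volume a b) :
    ∫ τ in a..b, M *ᵥ f τ = M *ᵥ ∫ τ in a..b, f τ :=
  (LinearMap.toContinuousLinearMap (Matrix.mulVecLin M)).intervalIntegral_comp_comm hf

theorem intervalIntegrable_of_Icc {E : Type*} [NormedAddCommGroup E] {f : ℝ → E} {a b : ℝ}
    (hab : a ≤ b) (hf : IntegrableOn f (Icc a b)) : IntervalIntegrable f volume a b :=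
  (intervalIntegrable_iff_integrableOn_Icc_of_le hab).2 hf

namespace LTI

variable {n i o : ℕ}

theorem continuous_exp_neg_mul (G : LTI n i o) :
    Continuous fun τ : ℝ => NormedSpace.exp (-τ • G.A) * G.B :=
  (continuous_exp.comp (by fun_prop : Continuous fun τ : ℝ => -τ • G.A)).matrix_mul
    continuous_const

/-- The state at time `t` is obtained from a primitive of `exp (-τ A) B w(τ)`. -/
theorem outputFrom_eq (G : LTI n i o) {s t : ℝ} (hst : s ≤ t) (x : Fin n → ℝ)
    {w : Signal (Fin i)} (hw : IntegrableOn w (Icc s t)) :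
    G.outputFrom s x w t = G.C *ᵥ (NormedSpace.exp (t • G.A) *ᵥ (NormedSpace.exp (-s • G.A) *ᵥ x
      + ∫ τ in s..t, (NormedSpace.exp (-τ • G.A) * G.B) *ᵥ w τ)) + G.D *ᵥ w t := by
  have h1 : ∀ τ, (G.C * NormedSpace.exp ((t - τ) • G.A) * G.B) *ᵥ w τ
      = (G.C * NormedSpace.exp (t • G.A)) *ᵥ ((NormedSpace.exp (-τ • G.A) * G.B) *ᵥ w τ) := by
    intro τ
    rw [exp_sub_smul, Matrix.mulVec_mulVec]
    simp only [Matrix.mul_assoc]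
  rw [outputFrom]
  simp_rw [h1]
  rw [intervalIntegral_mulVec _ (intervalIntegrable_of_Icc hst
    (integrableOn_mulVec G.continuous_exp_neg_mul hw)), exp_sub_smul]
  simp only [Matrix.mulVec_add, Matrix.mulVec_mulVec]

/-- The state is continuous, as a primitive of an integrable function times a continuous matrix; the
feedthrough term inherits local square integrability from `w`. -/
theorem memL2Loc_outputFrom (G : LTI n i o) (x : Fin n → ℝ) {w : Signal (Fin i)}
    (hw : MemL2Loc w) : MemL2Loc (G.outputFrom 0 x w) := by
  have hint : ∀ T, IntegrableOn (fun τ => (NormedSpace.exp (-τ • G.A) * G.B) *ᵥ w τ) (Icc 0 T) :=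
    fun T => integrableOn_mulVec G.continuous_exp_neg_mul (hw.integrableOn T)
  have hprim : ContinuousOn (fun t => ∫ τ in (0 : ℝ)..t,
      (NormedSpace.exp (-τ • G.A) * G.B) *ᵥ w τ) (Ici 0) := by
    intro t ht
    have h1 := intervalIntegral.continuousOn_primitive_interval
      (a := 0) (b := t + 1) (f := fun τ => (NormedSpace.exp (-τ • G.A) * G.B) *ᵥ w τ)
      (μ := volume) (by
        rw [uIcc_of_le (by have : (0 : ℝ) ≤ t := ht; linarith)]
        exact hint (t + 1))
    rw [uIcc_of_le (by have : (0 : ℝ) ≤ t := ht; linarith)] at h1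
    refine (h1 t ⟨ht, by linarith⟩).mono_of_mem_nhdsWithin ?_
    exact inter_mem_nhdsWithin _ (Iic_mem_nhds (by linarith))
  have hexp : Continuous fun t : ℝ => NormedSpace.exp (t • G.A) :=
    continuous_exp.comp (by fun_prop)
  have hcont : ContinuousOn (fun t : ℝ => G.C *ᵥ (NormedSpace.exp (t • G.A) *ᵥ
      (NormedSpace.exp (-(0 : ℝ) • G.A) *ᵥ x
        + ∫ τ in (0 : ℝ)..t, (NormedSpace.exp (-τ • G.A) * G.B) *ᵥ w τ))) (Ici 0) := by
    exact continuousOn_mulVec continuous_const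
      (continuousOn_mulVec hexp (continuousOn_const.add hprim))
  refine ((memL2Loc_of_continuousOn hcont).add (hw.mulVec G.D)).congr fun t ht => ?_
  rw [outputFrom_eq G ht x (hw.integrableOn t)]

/-- The weights `a` and `1 - a` sum to one, so the free response to the common initial state is
reproduced exactly. -/
theorem outputFrom_affine (G : LTI n i o) (x : Fin n → ℝ) {v w : Signal (Fin i)}
    (hv : MemL2Loc v) (hw : MemL2Loc w) (a : ℝ) {t : ℝ} (ht : 0 ≤ t) :
    G.outputFrom 0 x (a • v + (1 - a) • w) t
      = a • G.outputFrom 0 x v t + (1 - a) • G.outputFrom 0 x w t := by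
  have hv' := hv.integrableOn t
  have hw' := hw.integrableOn t
  have hvi := intervalIntegrable_of_Icc ht (integrableOn_mulVec G.continuous_exp_neg_mul hv')
  have hwi := intervalIntegrable_of_Icc ht (integrableOn_mulVec G.continuous_exp_neg_mul hw')
  have hvw : IntegrableOn (a • v + (1 - a) • w) (Icc 0 t) := (hv'.smul a).add (hw'.smul (1 - a))
  rw [outputFrom_eq G ht x hv', outputFrom_eq G ht x hw', outputFrom_eq G ht x hvw]
  have hsum : ∫ τ in (0 : ℝ)..t, (NormedSpace.exp (-τ • G.A) * G.B) *ᵥ (a • v + (1 - a) • w) τ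
      = a • (∫ τ in (0 : ℝ)..t, (NormedSpace.exp (-τ • G.A) * G.B) *ᵥ v τ)
        + (1 - a) • ∫ τ in (0 : ℝ)..t, (NormedSpace.exp (-τ • G.A) * G.B) *ᵥ w τ := by
    rw [← intervalIntegral.integral_smul, ← intervalIntegral.integral_smul]
    refine Eq.trans ?_ (intervalIntegral.integral_add (hvi.smul a) (hwi.smul (1 - a)))
    simp [Matrix.mulVec_add, Matrix.mulVec_smul]
  rw [hsum]
  simp only [Pi.add_apply, Pi.smul_apply, Matrix.mulVec_add, Matrix.mulVec_smul, smul_add]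
  module

/-- Variation of constants, for inputs for which the state equation holds with right derivatives. -/
theorem outputFrom_of_hasDerivWithinAt (G : LTI n i o) {x : Signal (Fin n)} {w : Signal (Fin i)}
    {s t : ℝ} (hst : s ≤ t) (hx : ContinuousOn x (Icc s t))
    (hd : ∀ τ ∈ Ico s t, HasDerivWithinAt x (G.A *ᵥ x τ + G.B *ᵥ w τ) (Ici τ) τ)
    (hw : IntegrableOn w (Icc s t)) :
    G.outputFrom s (x s) w t = G.C *ᵥ x t + G.D *ᵥ w t := by
  have hE : ∀ τ : ℝ, HasDerivAt (fun τ : ℝ => NormedSpace.exp (-τ • G.A))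
      (-(NormedSpace.exp (-τ • G.A) * G.A)) τ := by
    intro τ
    have h := (hasDerivAt_exp_smul_const (𝕂 := ℝ) G.A (-τ)).scomp τ (hasDerivAt_neg τ)
    rw [neg_one_smul] at h
    exact h
  -- Integrating factor: the drift `A x` cancels in the derivative of `exp (-τA) x(τ)`. Only right
  -- derivatives exist, since `w` may jump; with continuity of `x` they suffice for the fundamental
  -- theorem of calculus.
  have hbil : ∀ τ ∈ Ioo s t, HasDerivWithinAt (fun τ => NormedSpace.exp (-τ • G.A) *ᵥ x τ)
      ((NormedSpace.exp (-τ • G.A) * G.B) *ᵥ w τ) (Ioi τ) τ := by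
    intro τ hτ
    have hxτ := (hd τ ⟨hτ.1.le, hτ.2⟩).mono Ioi_subset_Ici_self
    rw [hasDerivWithinAt_pi] at hxτ ⊢
    intro a
    have hEab : ∀ b, HasDerivAt (fun τ : ℝ => NormedSpace.exp (-τ • G.A) a b)
        (-(NormedSpace.exp (-τ • G.A) * G.A) a b) τ := by
      intro b
      exact hasDerivAt_pi.1 (hasDerivAt_pi.1 (hE τ) a) b
    have h := HasDerivWithinAt.fun_sum (u := Finset.univ) fun b _ =>
      ((hEab b).hasDerivWithinAt (s := Ioi τ)).mul (hxτ b)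
    refine h.congr_deriv ?_
    rw [Finset.sum_add_distrib]
    change (-(NormedSpace.exp (-τ • G.A) * G.A) *ᵥ x τ
      + NormedSpace.exp (-τ • G.A) *ᵥ (G.A *ᵥ x τ + G.B *ᵥ w τ)) a = _
    rw [Matrix.neg_mulVec, Matrix.mulVec_add, Matrix.mulVec_mulVec, Matrix.mulVec_mulVec,
      neg_add_cancel_left]
  have hcont : ContinuousOn (fun τ => NormedSpace.exp (-τ • G.A) *ᵥ x τ) (Icc s t) := by
    have hexp : Continuous fun t : ℝ => NormedSpace.exp (-t • G.A) :=
      continuous_exp.comp (by fun_prop)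
    exact continuousOn_mulVec hexp hx
  have hftc := intervalIntegral.integral_eq_sub_of_hasDeriv_right_of_le hst hcont hbil
    (intervalIntegrable_of_Icc hst (integrableOn_mulVec G.continuous_exp_neg_mul hw))
  rw [outputFrom_eq G hst _ hw, hftc, add_sub_cancel, Matrix.mulVec_mulVec (x t), ← exp_sub_smul]
  simp

end LTI

/-! ### The `L²` gain of a stable linear system -/

theorem fourier_clm_apply {F G : Type*} [NormedAddCommGroup F] [NormedSpace ℂ F]
    [CompleteSpace F] [NormedAddCommGroup G] [NormedSpace ℂ G] [CompleteSpace G]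
    (L : F →L[ℂ] G) {f : ℝ → F} (hf : Integrable f) (ξ : ℝ) :
    𝓕 (fun t => L (f t)) ξ = L (𝓕 f ξ) := by
  rw [Real.fourier_eq, Real.fourier_eq, ← L.integral_comp_comm]
  · simp [Circle.smul_def]
  · exact (Real.fourierIntegral_convergent_iff ξ).2 hf

theorem fourier_add_apply {F : Type*} [NormedAddCommGroup F] [NormedSpace ℂ F]
    {f g : ℝ → F} (hf : Integrable f) (hg : Integrable g) (ξ : ℝ) :
    𝓕 (fun t => f t + g t) ξ = 𝓕 f ξ + 𝓕 g ξ := by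
  rw [Real.fourier_eq, Real.fourier_eq, Real.fourier_eq, ← integral_add]
  · simp
  · exact (Real.fourierIntegral_convergent_iff ξ).2 hf
  · exact (Real.fourierIntegral_convergent_iff ξ).2 hg

theorem memLp_two_of_integrable_of_bound {F : Type*} [NormedAddCommGroup F] {f : ℝ → F}
    (hf : Integrable f) {K : ℝ} (hK : ∀ t, ‖f t‖ ≤ K) : MemLp f 2 := by
  rw [memLp_two_iff_integrable_sq_norm hf.1]
  refine (hf.norm.const_mul K).mono' (hf.1.norm.pow 2) (Filter.Eventually.of_forall fun t => ?_)
  rw [Real.norm_of_nonneg (by positivity), sq]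
  exact mul_le_mul_of_nonneg_right (hK t) (norm_nonneg _)

theorem cvec_add {ι : Type} (x y : ι → ℝ) : cvec (x + y) = cvec x + cvec y := by
  ext j; simp [cvec]

theorem cvec_mulVec_eq {o i : ℕ} (M : Matrix (Fin o) (Fin i) ℝ) (x : Fin i → ℝ) :
    cvec (M *ᵥ x) = mulVecCLM o i (cplx M) (cvec x) :=
  cvec_mulVec M x

/-- `cvec` as a real continuous linear map. -/
noncomputable def cvecCLM (ι : Type) [Fintype ι] : (ι → ℝ) →L[ℝ] EuclideanSpace ℂ ι :=
  LinearMap.toContinuousLinearMap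
    { toFun := cvec
      map_add' := cvec_add
      map_smul' := fun c x => by ext j; simp [cvec] }

theorem continuous_cvec {ι : Type} [Fintype ι] : Continuous (cvec : (ι → ℝ) → _) :=
  (cvecCLM ι).continuous

theorem memLp_cvec {ι : Type} [Fintype ι] {f : Signal ι} {s : Set ℝ} {p : ENNReal}
    (hf : MemLp (fun t => (WithLp.toLp 2 (f t) : EuclideanSpace ℝ ι)) p (volume.restrict s)) :
    MemLp (fun t => cvec (f t)) p (volume.restrict s) := by
  refine hf.mono ?_ (Filter.Eventually.of_forall fun t => (norm_cvec _).le)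
  exact (continuous_cvec.comp (PiLp.continuous_ofLp 2 _)).comp_aestronglyMeasurable hf.1

theorem eLpNorm_cvec {ι : Type} [Fintype ι] (f : Signal ι) (s : Set ℝ) (p : ENNReal) :
    eLpNorm (fun t => cvec (f t)) p (volume.restrict s)
      = eLpNorm (fun t => (WithLp.toLp 2 (f t) : EuclideanSpace ℝ ι)) p (volume.restrict s) :=
  eLpNorm_congr_norm_ae (Filter.Eventually.of_forall fun _ => norm_cvec _)

namespace LTI

variable {n i o : ℕ}

/-- The complexification of the signal `w`, cut off outside `[0, T]`. -/
noncomputable def cutoff {ι : Type} (w : Signal ι) (T : ℝ) : ℝ → EuclideanSpace ℂ ι :=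
  (Icc 0 T).indicator fun t => cvec (w t)

/-- The response, from rest, of the complexified system. -/
noncomputable def response (G : LTI n i o) (W : ℝ → EuclideanSpace ℂ (Fin i)) :
    ℝ → EuclideanSpace ℂ (Fin o) := fun t =>
  mulVecCLM o n (cplx G.C) (convolution (expKernel (cplx G.A))
    (fun τ => mulVecCLM n i (cplx G.B) (W τ)) (mulVecCLM n n) volume t)
    + mulVecCLM o i (cplx G.D) (W t)

theorem integrable_convolution_expKernel (G : LTI n i o) (hG : G.Stable)
    {W : ℝ → EuclideanSpace ℂ (Fin i)} (hW : Integrable W) :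
    Integrable (convolution (expKernel (cplx G.A))
      (fun τ => mulVecCLM n i (cplx G.B) (W τ)) (mulVecCLM n n) volume) :=
  (integrable_expKernel hG).integrable_convolution _ (ContinuousLinearMap.integrable_comp _ hW)

theorem integrable_response (G : LTI n i o) (hG : G.Stable)
    {W : ℝ → EuclideanSpace ℂ (Fin i)} (hW : Integrable W) : Integrable (G.response W) :=
  (ContinuousLinearMap.integrable_comp _ (integrable_convolution_expKernel G hG hW)).add
    (ContinuousLinearMap.integrable_comp _ hW)

/-- The kernel is bounded as well as integrable, so the convolution with an integrable input is
bounded and integrable, hence square integrable. -/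
theorem memLp_convolution_expKernel (G : LTI n i o) (hG : G.Stable)
    {W : ℝ → EuclideanSpace ℂ (Fin i)} (hW : Integrable W) :
    MemLp (convolution (expKernel (cplx G.A))
      (fun τ => mulVecCLM n i (cplx G.B) (W τ)) (mulVecCLM n n) volume) 2 := by
  obtain ⟨K, hK⟩ := exists_norm_expKernel_le hG
  have hBW := ContinuousLinearMap.integrable_comp (mulVecCLM n i (cplx G.B)) hW
  refine memLp_two_of_integrable_of_bound (integrable_convolution_expKernel G hG hW)
    (K := ∫ τ, K * ‖mulVecCLM n i (cplx G.B) (W τ)‖) fun t => ?_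
  rw [convolution_eq_swap]
  refine norm_integral_le_of_norm_le (hBW.norm.const_mul K)
    (Filter.Eventually.of_forall fun τ => ?_)
  exact (norm_mulVecCLM_le _ _).trans (mul_le_mul_of_nonneg_right (hK _) (norm_nonneg _))

theorem memLp_response (G : LTI n i o) (hG : G.Stable)
    {W : ℝ → EuclideanSpace ℂ (Fin i)} (hW : Integrable W) (hW2 : MemLp W 2) :
    MemLp (G.response W) 2 := by
  have h1 := (mulVecCLM o n (cplx G.C)).comp_memLp' (memLp_convolution_expKernel G hG hW)
  have h2 := (mulVecCLM o i (cplx G.D)).comp_memLp' hW2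
  exact h1.add h2

theorem fourier_response (G : LTI n i o) (hG : G.Stable)
    {W : ℝ → EuclideanSpace ℂ (Fin i)} (hW : Integrable W) (ξ : ℝ) :
    𝓕 (G.response W) ξ
      = mulVecCLM o i (G.transfer (Complex.I * ((2 * Real.pi * ξ : ℝ) : ℂ))) (𝓕 W ξ) := by
  have hconv := integrable_convolution_expKernel G hG hW
  have hBW := ContinuousLinearMap.integrable_comp (mulVecCLM n i (cplx G.B)) hW
  unfold response
  rw [fourier_add_apply (ContinuousLinearMap.integrable_comp _ hconv)
    (ContinuousLinearMap.integrable_comp _ hW), fourier_clm_apply _ hconv, fourier_clm_apply _ hW,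
    Real.fourier_bilin_convolution_eq _ (integrable_expKernel hG) hBW, fourier_clm_apply _ hW,
    fourier_expKernel hG, transfer, map_add, _root_.add_apply, mulVecCLM_mul,
    mulVecCLM_mul]

theorem norm_transfer_le (G : LTI n i o) {η : ℝ} (hη : 0 ≤ η)
    (h : G.hinfNorm ≤ ENNReal.ofReal η) (ω : ℝ) : ‖G.transfer (Complex.I * (ω : ℂ))‖ ≤ η := by
  have h1 := (le_iSup (fun ω : ℝ => ‖G.transfer (Complex.I * (ω : ℂ))‖ₑ) ω).trans h
  rwa [← ofReal_norm, ENNReal.ofReal_le_ofReal_iff hη] at h1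

/-- Causality: for `t ≤ T` the kernel vanishes for `τ > t` and the cut-off input for `τ < 0`, so the
convolution over the line reduces to the integral over `[0, t]`. -/
theorem response_cutoff (G : LTI n i o) {w : Signal (Fin i)} (hw : MemL2Loc w) {T t : ℝ}
    (ht : t ∈ Icc 0 T) : G.response (cutoff w T) t = cvec (G.outputFrom 0 0 w t) := by
  have hK : Continuous fun τ : ℝ => G.C * NormedSpace.exp ((t - τ) • G.A) * G.B :=
    (continuous_const.matrix_mul (continuous_exp.comp
      (by fun_prop : Continuous fun τ : ℝ => (t - τ) • G.A))).matrix_mul continuous_const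
  have hE : Continuous fun τ : ℝ => NormedSpace.exp ((t - τ) • G.A) * G.B :=
    (continuous_exp.comp (by fun_prop : Continuous fun τ : ℝ => (t - τ) • G.A)).matrix_mul
      continuous_const
  have hEi := integrableOn_mulVec hE (hw.integrableOn t)
  have h1 : ∀ τ, mulVecCLM n n (expKernel (cplx G.A) (t - τ))
      (mulVecCLM n i (cplx G.B) (cutoff w T τ))
      = (Icc 0 t).indicator (fun τ => cvec ((NormedSpace.exp ((t - τ) • G.A) * G.B) *ᵥ w τ)) τ := by
    intro τ
    by_cases hτ : τ ∈ Icc 0 t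
    · have h0 : t - τ ∈ Ici (0 : ℝ) := sub_nonneg.2 hτ.2
      have hT : τ ∈ Icc 0 T := ⟨hτ.1, hτ.2.trans ht.2⟩
      rw [indicator_of_mem hτ, cutoff, indicator_of_mem hT, expKernel, indicator_of_mem h0,
        cvec_mulVec_eq, cplx_mul, mulVecCLM_mul, cplx_exp]
    · rw [indicator_of_notMem hτ]
      by_cases h0 : 0 ≤ τ
      · have h2 : t - τ ∉ Ici (0 : ℝ) := fun h => hτ ⟨h0, sub_nonneg.1 h⟩
        rw [expKernel, indicator_of_notMem h2, map_zero, _root_.zero_apply]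
      · have h2 : τ ∉ Icc 0 T := fun h => h0 h.1
        rw [cutoff, indicator_of_notMem h2, map_zero, map_zero]
  have h2 : ∫ τ in (0 : ℝ)..t, (G.C * NormedSpace.exp ((t - τ) • G.A) * G.B) *ᵥ w τ
      = G.C *ᵥ ∫ τ in (0 : ℝ)..t, (NormedSpace.exp ((t - τ) • G.A) * G.B) *ᵥ w τ := by
    rw [← intervalIntegral_mulVec _ (intervalIntegrable_of_Icc ht.1 hEi)]
    simp only [Matrix.mulVec_mulVec, Matrix.mul_assoc]
  rw [response, convolution_eq_swap]
  simp_rw [h1]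
  rw [integral_indicator measurableSet_Icc, outputFrom, h2, Matrix.mulVec_zero, zero_add, cvec_add,
    cvec_mulVec_eq, cvec_mulVec_eq, cutoff, indicator_of_mem ht,
    intervalIntegral.integral_of_le ht.1, ← integral_Icc_eq_integral_Ioc]
  congr 2
  exact (cvecCLM (Fin n)).integral_comp_comm hEi

/-- The `L²` gain of a stable system is at most its `H∞` norm, on bounded time intervals. -/
theorem eLpNorm_outputFrom_Icc_le (G : LTI n i o) (hG : G.Stable) {η : ℝ} (hη : 0 ≤ η)
    (h : G.hinfNorm ≤ ENNReal.ofReal η) {w : Signal (Fin i)} (hw : MemL2Loc w) (T : ℝ) :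
    eLpNorm (fun t => (WithLp.toLp 2 (G.outputFrom 0 0 w t) : EuclideanSpace ℝ (Fin o))) 2
        (volume.restrict (Icc 0 T))
      ≤ ENNReal.ofReal η * eLpNorm (fun t => (WithLp.toLp 2 (w t) : EuclideanSpace ℝ (Fin i))) 2
        (volume.restrict (Icc 0 T)) := by
  have hW2 : MemLp (cutoff w T) 2 :=
    (memLp_indicator_iff_restrict measurableSet_Icc).2 (memLp_cvec (hw T))
  have hW : Integrable (cutoff w T) :=
    (integrable_indicator_iff measurableSet_Icc).2
      ((memLp_cvec (hw T)).integrable one_le_two)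
  have hWn : eLpNorm (cutoff w T) 2 volume
      = eLpNorm (fun t => (WithLp.toLp 2 (w t) : EuclideanSpace ℝ (Fin i))) 2
        (volume.restrict (Icc 0 T)) := by
    rw [cutoff, eLpNorm_indicator_eq_eLpNorm_restrict measurableSet_Icc, eLpNorm_cvec]
  rw [← hWn, ← eLpNorm_cvec]
  calc _ = eLpNorm (G.response (cutoff w T)) 2 (volume.restrict (Icc 0 T)) :=
        eLpNorm_congr_ae (by
          filter_upwards [ae_restrict_mem measurableSet_Icc] with t ht
          rw [response_cutoff G hw ht])
    -- The response may continue after `T`; including that tail only increases the norm and allows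
    -- Plancherel on the whole line.
    _ ≤ eLpNorm (G.response (cutoff w T)) 2 volume := eLpNorm_restrict_le _ _ _ _
    _ ≤ _ := by
      refine eLpNorm_le_of_fourier_le hW hW2 (integrable_response G hG hW)
        (memLp_response G hG hW hW2) fun ξ => ?_
      rw [fourier_response G hG hW]
      exact (norm_mulVecCLM_le _ _).trans
        (mul_le_mul_of_nonneg_right (norm_transfer_le G hη h _) (norm_nonneg _))

/-- The bounds on `[0, k]` are uniform in `k`, so they pass to the half line by monotone
convergence; square integrability of the output is a consequence, not an assumption. -/
theorem eLpNorm_outputFrom_le (G : LTI n i o) (hG : G.Stable) {η : ℝ} (hη : 0 ≤ η)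
    (h : G.hinfNorm ≤ ENNReal.ofReal η) {w : Signal (Fin i)} (hw : MemL2Loc w) :
    eLpNorm (fun t => (WithLp.toLp 2 (G.outputFrom 0 0 w t) : EuclideanSpace ℝ (Fin o))) 2
        (volume.restrict (Ici (0 : ℝ)))
      ≤ ENNReal.ofReal η * eLpNorm (fun t => (WithLp.toLp 2 (w t) : EuclideanSpace ℝ (Fin i))) 2
        (volume.restrict (Ici (0 : ℝ))) := by
  set c := ENNReal.ofReal η * eLpNorm (fun t => (WithLp.toLp 2 (w t) : EuclideanSpace ℝ (Fin i))) 2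
        (volume.restrict (Ici (0 : ℝ)))
  have h1 : ∀ k : ℕ, eLpNorm (fun t =>
      (WithLp.toLp 2 (G.outputFrom 0 0 w t) : EuclideanSpace ℝ (Fin o))) 2
        (volume.restrict (Icc (0 : ℝ) k)) ≤ c := fun k =>
    (eLpNorm_outputFrom_Icc_le G hG hη h hw k).trans (mul_le_mul_right (eLpNorm_mono_measure _
      (Measure.restrict_mono Icc_subset_Ici_self le_rfl)) _)
  have hdir : Directed (· ⊆ ·) fun k : ℕ => Icc (0 : ℝ) k :=
    directed_of_isDirected_le fun a b hab => Icc_subset_Icc_right (by exact_mod_cast hab)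
  simp only [eLpNorm_eq_lintegral_rpow_enorm_toReal (two_ne_zero) (ENNReal.ofNat_ne_top),
    ENNReal.toReal_ofNat, one_div] at h1 ⊢
  rw [ENNReal.rpow_inv_le_iff two_pos, Ici_zero_eq_iUnion_Icc,
    setLIntegral_iUnion_of_directed _ hdir]
  exact iSup_le fun k => (ENNReal.rpow_inv_le_iff two_pos).1 (h1 k)

theorem memL2_outputFrom (G : LTI n i o) (hG : G.Stable) {η : ℝ} (hη : 0 ≤ η)
    (h : G.hinfNorm ≤ ENNReal.ofReal η) {w : Signal (Fin i)} (hw : MemL2 w) :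
    MemL2 (G.outputFrom 0 0 w) :=
  ⟨(memL2Loc_outputFrom G 0 hw.memL2Loc).aestronglyMeasurable,
    (eLpNorm_outputFrom_le G hG hη h hw.memL2Loc).trans_lt
      (ENNReal.mul_lt_top ENNReal.ofReal_lt_top hw.2)⟩

theorem energy_outputFrom_le (G : LTI n i o) (hG : G.Stable) {η : ℝ} (hη : 0 ≤ η)
    (h : G.hinfNorm ≤ ENNReal.ofReal η) {w : Signal (Fin i)} (hw : MemL2 w) :
    energy (G.outputFrom 0 0 w) ≤ η ^ 2 * energy w := by
  have h1 := ENNReal.toReal_mono (ENNReal.mul_lt_top ENNReal.ofReal_lt_top hw.2).ne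
    (eLpNorm_outputFrom_le G hG hη h hw.memL2Loc)
  rw [ENNReal.toReal_mul, ENNReal.toReal_ofReal hη] at h1
  rw [energy_eq (memL2_outputFrom G hG hη h hw), energy_eq hw, ← mul_pow]
  exact pow_le_pow_left₀ ENNReal.toReal_nonneg h1 2

end LTI

/-! ### Plancherel -/

/-- Plancherel is isometric in `ξ`; the substitution `ω = 2πξ` produces the factor `2π`. -/
theorem freqEnergy_eq {ι : Type} [Fintype ι] {f : Signal ι} (hf : MemL2 f) :
    freqEnergy f = 2 * Real.pi * energy f := by
  have hc : MemLp (causal f) 2 (volume : Measure ℝ) :=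
    (memLp_indicator_iff_restrict measurableSet_Ici).2 (memLp_cvec hf)
  have h1 : ∀ ω, freq f ω = (𝓕 (hc.toLp (causal f)) : Lp (EuclideanSpace ℂ ι) 2
      (volume : Measure ℝ)) (ω / (2 * Real.pi)) := fun ω => by rw [freq, dif_pos hc]
  set g := (𝓕 (hc.toLp (causal f)) : Lp (EuclideanSpace ℂ ι) 2 (volume : Measure ℝ))
  have h2 : ∫ ξ, ‖g ξ‖ ^ 2 = ‖g‖ ^ 2 := by
    have := L2.inner_def (𝕜 := ℂ) g g
    rw [inner_self_eq_norm_sq_to_K] at this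
    simp only [inner_self_eq_norm_sq_to_K] at this
    have h3 : (∫ ξ, ((‖g ξ‖ : ℂ)) ^ 2) = ((∫ ξ, ‖g ξ‖ ^ 2 : ℝ) : ℂ) := by
      rw [← integral_complex_ofReal]
      simp
    exact Complex.ofReal_injective (h3.symm.trans (this.symm.trans (by simp)))
  have h4 : ‖g‖ ^ 2 = energy f := by
    rw [Lp.norm_fourier_eq, Lp.norm_toLp, energy_eq hf, causal,
      eLpNorm_indicator_eq_eLpNorm_restrict measurableSet_Ici]
    exact congrArg (fun x : ENNReal => x.toReal ^ 2) (eLpNorm_cvec f _ 2)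
  unfold freqEnergy
  simp_rw [h1]
  rw [Measure.integral_comp_div (fun ξ => ‖g ξ‖ ^ 2) (2 * Real.pi), h2, h4, smul_eq_mul,
    abs_of_pos Real.two_pi_pos]

/-! ### Energies of stacked signals and of the decaying threshold -/

theorem energy_elim {ι κ : Type} [Fintype ι] [Fintype κ] {f : Signal ι} {g : Signal κ}
    (hf : MemL2 f) (hg : MemL2 g) :
    energy (fun t => Sum.elim (f t) (g t)) = energy f + energy g := by
  rw [energy, energy, energy, ← integral_add hf.integrable_dotProduct hg.integrable_dotProduct]
  simp only [sumElim_dotProduct_sumElim]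

theorem memL2_elim {ι κ : Type} [Fintype ι] [Fintype κ] {f : Signal ι} {g : Signal κ}
    (hf : MemL2 f) (hg : MemL2 g) : MemL2 (fun t => Sum.elim (f t) (g t)) :=
  memL2_iff.2 fun i => by
    rcases i with i | i
    · exact memL2_iff.1 hf i
    · exact memL2_iff.1 hg i

theorem energy_nonneg {ι : Type} [Fintype ι] (f : Signal ι) : 0 ≤ energy f :=
  integral_nonneg fun t => by
    rw [← norm_sq_toLp]; positivity

theorem MemL2.congr {ι : Type} [Fintype ι] {f g : Signal ι} (hf : MemL2 f)
    (h : ∀ t, 0 ≤ t → f t = g t) : MemL2 g :=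
  (memLp_congr_ae (by
    filter_upwards [ae_restrict_mem measurableSet_Ici] with t ht
    rw [h t ht])).1 hf

theorem energy_congr {ι : Type} [Fintype ι] {f g : Signal ι} (h : ∀ t, 0 ≤ t → f t = g t) :
    energy f = energy g :=
  setIntegral_congr_fun measurableSet_Ici fun t ht => by simp only [h t ht]

theorem l2norm_le_of_energy_le {ι κ : Type} [Fintype ι] [Fintype κ] {f : Signal ι} {g : Signal κ}
    {γ β : ℝ} (hγ : 0 ≤ γ) (hβ : 0 ≤ β) (h : energy f ≤ γ ^ 2 * energy g + β) :
    l2norm f ≤ γ * l2norm g + √β := by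
  have hg := Real.sqrt_nonneg (energy g)
  refine Real.sqrt_le_iff.2 ⟨add_nonneg (mul_nonneg hγ hg) (Real.sqrt_nonneg β), h.trans ?_⟩
  rw [add_sq, mul_pow, l2norm, Real.sq_sqrt (energy_nonneg g), Real.sq_sqrt hβ]
  have : 0 ≤ 2 * (γ * √(energy g)) * √β := by positivity
  linarith

theorem integrableOn_exp_decay {μ ν : ℝ} (hν : 0 < ν) :
    IntegrableOn (fun t : ℝ => μ * Real.exp (-ν * t)) (Ici 0) :=
  ((integrableOn_Ici_iff_integrableOn_Ioi).2 (exp_neg_integrableOn_Ioi 0 hν)).const_mul μ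

theorem integral_exp_decay {μ ν : ℝ} (hν : 0 < ν) :
    ∫ t in Ici (0 : ℝ), μ * Real.exp (-ν * t) = μ / ν := by
  rw [integral_const_mul, integral_Ici_eq_integral_Ioi, integral_exp_mul_Ioi (by linarith)]
  simp [div_eq_mul_inv]

/-! ### The gain bound for `Γ` under the triggering condition -/

namespace Loop

variable {n nK nΔ p m : ℕ} (S : Loop n nK nΔ p m)

theorem sq_gain (η : ℝ) : S.gain η ^ 2
    = max (specRad S.Ω₁) (specRad (S.Ω₂ + η ^ 2 • (1 : Matrix (Fin m) (Fin m) ℝ))) :=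
  Real.sq_sqrt (le_max_of_le_left (specRad_nonneg _))

theorem gain_pos (hpm : 0 < p + m) (hΩ₁ : S.Ω₁.PosDef) (hΩ₂ : S.Ω₂.PosDef) (η : ℝ) :
    0 < S.gain η := by
  refine Real.sqrt_pos.2 (lt_max_iff.2 ?_)
  -- The spectral radius of an empty matrix is not positive, so a block of positive size is needed;
  -- `p + m > 0` provides one.
  rcases Nat.eq_zero_or_pos p with hp | hp
  · exact Or.inr (specRad_pos (hΩ₂.add_posSemidef (PosSemidef.one.smul (sq_nonneg η))) (by omega))
  · exact Or.inl (specRad_pos hΩ₁ hp)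

/-- The weighted size of the samples. -/
theorem dotProduct_weight (v : Fin p ⊕ Fin m → ℝ) :
    v ⬝ᵥ (fromBlocks S.Ω₁ 0 0 S.Ω₂ *ᵥ v)
      = (v ∘ Sum.inl) ⬝ᵥ (S.Ω₁ *ᵥ (v ∘ Sum.inl)) + (v ∘ Sum.inr) ⬝ᵥ (S.Ω₂ *ᵥ (v ∘ Sum.inr)) := by
  rw [fromBlocks_mulVec]
  conv_lhs => rw [← Sum.elim_comp_inl_inr v]
  simp only [sumElim_dotProduct_sumElim, Sum.elim_comp_inl, Sum.elim_comp_inr, zero_mulVec,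
    add_zero, zero_add]

/-- The term `η² |û|²` is absorbed into the second block, which becomes `Ω₂ + η² I`; each block is
then bounded by its spectral radius. This is what fixes the form of `γ`. -/
theorem weight_le (hΩ₁ : S.Ω₁.PosDef) (hΩ₂ : S.Ω₂.PosDef) (η : ℝ) (v : Fin p ⊕ Fin m → ℝ) :
    v ⬝ᵥ (fromBlocks S.Ω₁ 0 0 S.Ω₂ *ᵥ v) + η ^ 2 * ((v ∘ Sum.inr) ⬝ᵥ (v ∘ Sum.inr))
      ≤ S.gain η ^ 2 * (v ⬝ᵥ v) := by
  have hv : v ⬝ᵥ v = (v ∘ Sum.inl) ⬝ᵥ (v ∘ Sum.inl) + (v ∘ Sum.inr) ⬝ᵥ (v ∘ Sum.inr) := by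
    simp [dotProduct]
  have hH : (S.Ω₂ + η ^ 2 • (1 : Matrix (Fin m) (Fin m) ℝ)).IsHermitian :=
    (hΩ₂.add_posSemidef (PosSemidef.one.smul (sq_nonneg η))).1
  have h1 := dotProduct_mulVec_le hΩ₁.1 (v ∘ Sum.inl)
  have h2 := dotProduct_mulVec_le hH (v ∘ Sum.inr)
  rw [add_mulVec, dotProduct_add, smul_mulVec, one_mulVec, dotProduct_smul, smul_eq_mul] at h2
  have h3 : 0 ≤ (v ∘ Sum.inl) ⬝ᵥ (v ∘ Sum.inl) := by rw [← norm_sq_toLp]; positivity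
  have h4 : 0 ≤ (v ∘ Sum.inr) ⬝ᵥ (v ∘ Sum.inr) := by rw [← norm_sq_toLp]; positivity
  have h5 := mul_le_mul_of_nonneg_right (le_max_left (specRad S.Ω₁)
    (specRad (S.Ω₂ + η ^ 2 • (1 : Matrix (Fin m) (Fin m) ℝ)))) h3
  have h6 := mul_le_mul_of_nonneg_right (le_max_right (specRad S.Ω₁)
    (specRad (S.Ω₂ + η ^ 2 • (1 : Matrix (Fin m) (Fin m) ℝ)))) h4
  rw [dotProduct_weight, sq_gain, hv, mul_add]
  linarith

variable (xp₀ : Fin n → ℝ) (xk₀ : Fin nK → ℝ)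

theorem memL2Loc_Γε {v : Signal (Fin p ⊕ Fin m)} (hv : MemL2Loc v) :
    MemL2Loc (S.Γε xp₀ xk₀ v) :=
  memL2Loc_elim
    ((hv.inl.sub (S.plant.memL2Loc_outputFrom xp₀ hv.inr)).sub (S.Δ.memL2Loc_outputFrom 0 hv.inr))
    (hv.inr.sub (S.K.memL2Loc_outputFrom xk₀ hv.inl))

theorem isAffineOperator_Γ : IsAffineOperator (S.Γ xp₀ xk₀) := by
  refine ⟨fun v hv => memL2Loc_elim (S.memL2Loc_Γε xp₀ xk₀ hv)
    (S.Δ.memL2Loc_outputFrom 0 hv.inr), fun v w hv hw a t ht => ?_⟩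
  have h1 : S.plant.outputFrom 0 xp₀ (fun t i => (a • v + (1 - a) • w) t (Sum.inr i)) t = _ :=
    S.plant.outputFrom_affine xp₀ hv.inr hw.inr a ht
  have h2 : S.Δ.outputFrom 0 0 (fun t i => (a • v + (1 - a) • w) t (Sum.inr i)) t = _ :=
    S.Δ.outputFrom_affine 0 hv.inr hw.inr a ht
  have h3 : S.K.outputFrom 0 xk₀ (fun t i => (a • v + (1 - a) • w) t (Sum.inl i)) t = _ :=
    S.K.outputFrom_affine xk₀ hv.inl hw.inl a ht
  simp only [Γ, Γε]
  rw [h1, h2, h3]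
  ext i
  rcases i with (i | i) | i <;>
    simp only [Sum.elim_inl, Sum.elim_inr, Pi.add_apply, Pi.sub_apply, Pi.smul_apply,
      smul_eq_mul] <;>
    ring

/-- Under the triggering condition `Γ` is square integrable, with the quadratic energy bound. -/
theorem memL2_Γ_and_energy_le (hΩ₁ : S.Ω₁.PosDef) (hΩ₂ : S.Ω₂.PosDef) (hν : 0 < S.ν)
    {η : ℝ} (hη : 0 ≤ η) (hΔ : S.Δ.Stable) (hΔη : S.Δ.hinfNorm ≤ ENNReal.ofReal η)
    {v : Signal (Fin p ⊕ Fin m)} (hadm : v ∈ S.admissible xp₀ xk₀) (hv : MemL2 v) :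
    MemL2 (S.Γ xp₀ xk₀ v) ∧
      energy (S.Γ xp₀ xk₀ v) ≤ S.gain η ^ 2 * energy v + S.μ / S.ν := by
  -- The negative term `-η² |û|²` is kept in reserve: after integration it pays for the energy of
  -- `d`, which is bounded only in the integrated sense.
  have hbound : ∀ᵐ t ∂(volume.restrict (Ici (0 : ℝ))),
      S.Γε xp₀ xk₀ v t ⬝ᵥ S.Γε xp₀ xk₀ v t ≤ S.gain η ^ 2 * (v t ⬝ᵥ v t)
        - η ^ 2 * ((fun i => v t (Sum.inr i)) ⬝ᵥ fun i => v t (Sum.inr i))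
        + S.μ * Real.exp (-S.ν * t) := by
    filter_upwards [hadm] with t ht
    have h1 := S.weight_le hΩ₁ hΩ₂ η (v t)
    change _ ≤ S.gain η ^ 2 * (v t ⬝ᵥ v t) - η ^ 2 * ((v t ∘ Sum.inr) ⬝ᵥ (v t ∘ Sum.inr)) + _
    simp only [trigger] at ht
    linarith
  have hi1 := hv.integrable_dotProduct.const_mul (S.gain η ^ 2)
  have hi2 := hv.inr.integrable_dotProduct.const_mul (η ^ 2)
  have hi3 := integrableOn_exp_decay (μ := S.μ) hν
  have hi := (hi1.sub hi2).add hi3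
  have hε : MemL2 (S.Γε xp₀ xk₀ v) := by
    have hm := (S.memL2Loc_Γε xp₀ xk₀ hv.memL2Loc).aestronglyMeasurable
    refine (memLp_two_iff_integrable_sq_norm hm).2 (hi.mono' (hm.norm.pow 2) ?_)
    filter_upwards [hbound] with t ht
    rw [Real.norm_of_nonneg (by positivity), norm_sq_toLp]
    exact ht
  have hd := S.Δ.memL2_outputFrom hΔ hη hΔη hv.inr
  refine ⟨memL2_elim hε hd, ?_⟩
  have hεle : energy (S.Γε xp₀ xk₀ v) ≤ S.gain η ^ 2 * energy v
      - η ^ 2 * energy (fun t i => v t (Sum.inr i)) + S.μ / S.ν := by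
    refine (integral_mono_ae hε.integrable_dotProduct hi hbound).trans_eq ?_
    rw [energy, energy, ← integral_exp_decay hν, ← integral_const_mul, ← integral_const_mul,
      ← integral_sub hi1 hi2]
    exact integral_add (hi1.sub hi2) hi3
  have hdle := S.Δ.energy_outputFrom_le hΔ hη hΔη hv.inr
  have := energy_elim hε hd
  change energy (S.Γ xp₀ xk₀ v) = _ at this
  rw [this]
  linarith

end Loop

/-! ### Runs of the closed loop -/

namespace Loop.IsRun

variable {n nK nΔ p m : ℕ} {S : Loop n nK nΔ p m} {X : Traj n nK nΔ p m}

theorem monotone_T (hX : S.IsRun X) : Monotone X.T :=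
  monotone_nat_of_le_succ fun k => by
    rw [hX.next k]
    refine le_sInf ?_
    rintro _ ⟨t, ht, rfl⟩
    exact ht.1.le

theorem coe_toReal_T (hX : S.IsRun X) {k : ℕ} {t : ℝ} (ht : X.T k ≤ (t : EReal)) :
    (((X.T k).toReal : ℝ) : EReal) = X.T k := by
  have h0 : (0 : EReal) ≤ X.T k := hX.start ▸ hX.monotone_T (Nat.zero_le k)
  exact EReal.coe_toReal (ht.trans_lt (EReal.coe_lt_top t)).ne
    (EReal.bot_lt_zero.trans_le h0).ne'

theorem toReal_T_nonneg (hX : S.IsRun X) (k : ℕ) : 0 ≤ (X.T k).toReal :=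
  EReal.toReal_nonneg (hX.start ▸ hX.monotone_T (Nat.zero_le k))

theorem toReal_T_le (hX : S.IsRun X) {k : ℕ} {t : ℝ} (ht : X.T k ≤ (t : EReal)) :
    (X.T k).toReal ≤ t := by
  rw [← hX.coe_toReal_T ht] at ht
  exact_mod_cast ht

theorem hold (hX : S.IsRun X) {k : ℕ} {t : ℝ} (h1 : X.T k ≤ (t : EReal))
    (h2 : (t : EReal) < X.T (k + 1)) :
    X.yh (X.T k).toReal = X.yh t ∧ X.uh (X.T k).toReal = X.uh t := by
  have hs := hX.coe_toReal_T h1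
  have h3 := hX.sample k t h1 h2
  have h4 := hX.sample k (X.T k).toReal hs.ge (hs.trans_lt (h1.trans_lt h2))
  exact ⟨h4.1.trans h3.1.symm, h4.2.trans h3.2.symm⟩

/-- At a triggering instant the error has just been reset to zero, so `f < 0`. Strictly between
instants, `f > 0` would put `t` in the set whose infimum is the next instant, although `t` lies
before it. -/
theorem trigger_nonpos (hX : S.IsRun X) (hΩ₁ : S.Ω₁.PosDef) (hΩ₂ : S.Ω₂.PosDef) (hμ : 0 < S.μ)
    {t : ℝ} (ht : 0 ≤ t) : S.trigger (S.ε X t) (X.v t) t ≤ 0 := by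
  obtain ⟨k, h1, h2⟩ := hX.cover t ht
  obtain ⟨hy, hu⟩ := hX.hold h1 h2
  rcases h1.eq_or_lt with h | h
  · have hs : (X.T k).toReal = t := by rw [h, EReal.toReal_coe]
    obtain ⟨h3, h4⟩ := hX.sample k t h1 h2
    rw [hs] at h3 h4
    have hε : S.ε X t = 0 := by
      ext i
      rcases i with i | i <;> simp [Loop.ε, h3, h4]
    have hw : 0 ≤ X.v t ⬝ᵥ (fromBlocks S.Ω₁ 0 0 S.Ω₂ *ᵥ X.v t) := by
      rw [S.dotProduct_weight]
      have a := hΩ₁.posSemidef.dotProduct_mulVec_nonneg (X.v t ∘ Sum.inl)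
      have b := hΩ₂.posSemidef.dotProduct_mulVec_nonneg (X.v t ∘ Sum.inr)
      simp only [star_trivial] at a b
      exact add_nonneg a b
    have he : 0 < S.μ * Real.exp (-S.ν * t) := by positivity
    rw [Loop.trigger, hε, dotProduct_zero]
    linarith
  · by_contra! hpos
    have hheld : S.heldError X (X.T k).toReal t = S.ε X t := by
      simp only [Loop.heldError, Loop.ε, Loop.y, Loop.u, Loop.d, hy, hu]
    have hv : X.v (X.T k).toReal = X.v t := by simp only [Traj.v, hy, hu]
    rw [hX.next k] at h2
    refine h2.not_ge (sInf_le ⟨t, ⟨h, ?_⟩, rfl⟩)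
    rw [hheld, hv]
    exact hpos.le

/-- A signal that is held between the triggering instants is integrable on bounded intervals. -/
theorem integrableOn_of_hold (hX : S.IsRun X) {ι : Type} [Fintype ι] {w : Signal ι}
    (hw : ∀ k (t : ℝ), X.T k ≤ (t : EReal) → (t : EReal) < X.T (k + 1) →
      w t = w (X.T k).toReal) (t : ℝ) : IntegrableOn w (Icc 0 t) := by
  rcases lt_or_ge t 0 with ht | ht
  · rw [Icc_eq_empty (not_le.2 ht)]
    exact integrableOn_empty
  obtain ⟨k, h1, h2⟩ := hX.cover t ht
  -- Absence of Zeno behaviour enters here: `t` lies in some holding interval `k`, so by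
  -- monotonicity of the instants only the intervals up to `k` meet `[0, t]`.
  have hsub : Icc 0 t ⊆ ⋃ j ∈ Finset.range (k + 1),
      (Icc 0 t ∩ ((fun s : ℝ => (s : EReal)) ⁻¹' Ico (X.T j) (X.T (j + 1)))) := by
    intro s hs
    obtain ⟨j, hj1, hj2⟩ := hX.cover s hs.1
    refine mem_biUnion (Finset.mem_coe.2 (Finset.mem_range.2 ?_)) ⟨hs, hj1, hj2⟩
    by_contra! hjk
    have h3 : X.T (k + 1) ≤ (s : EReal) := (hX.monotone_T hjk).trans hj1
    exact (h2.trans_le h3).not_ge (by exact_mod_cast hs.2)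
  refine IntegrableOn.mono_set ((integrableOn_finset_iUnion).2 fun j _ => ?_) hsub
  have hmeas : MeasurableSet
      (Icc 0 t ∩ ((fun s : ℝ => (s : EReal)) ⁻¹' Ico (X.T j) (X.T (j + 1)))) :=
    measurableSet_Icc.inter (measurable_coe_real_ereal measurableSet_Ico)
  refine IntegrableOn.congr_fun (f := fun _ => w (X.T j).toReal) ?_
    (fun s hs => (hw j s hs.2.1 hs.2.2).symm) hmeas
  exact integrableOn_const (measure_ne_top_of_subset inter_subset_left isCompact_Icc.measure_ne_top)

theorem integrableOn_yh (hX : S.IsRun X) (t : ℝ) : IntegrableOn X.yh (Icc 0 t) :=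
  hX.integrableOn_of_hold (fun _ _ h1 h2 => (hX.hold h1 h2).1.symm) t

theorem integrableOn_uh (hX : S.IsRun X) (t : ℝ) : IntegrableOn X.uh (Icc 0 t) :=
  hX.integrableOn_of_hold (fun _ _ h1 h2 => (hX.hold h1 h2).2.symm) t

theorem plant_outputFrom (hX : S.IsRun X) {s t : ℝ} (hs : 0 ≤ s) (hst : s ≤ t) :
    S.plant.outputFrom s (X.xp s) X.uh t = S.C *ᵥ X.xp t := by
  have hsub : Icc s t ⊆ Ici 0 := fun τ hτ => hs.trans hτ.1
  have h := S.plant.outputFrom_of_hasDerivWithinAt (w := X.uh) hst (hX.xp_cont.mono hsub)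
    (fun τ hτ => hX.xp_deriv τ (hs.trans hτ.1))
    ((hX.integrableOn_uh t).mono_set (Icc_subset_Icc_left hs))
  simpa [Loop.plant] using h

theorem controller_outputFrom (hX : S.IsRun X) {s t : ℝ} (hs : 0 ≤ s) (hst : s ≤ t) :
    S.K.outputFrom s (X.xk s) X.yh t = S.u X t :=
  S.K.outputFrom_of_hasDerivWithinAt (w := X.yh) hst
    (hX.xk_cont.mono fun _ hτ => hs.trans hτ.1)
    (fun τ hτ => hX.xk_deriv τ (hs.trans hτ.1))
    ((hX.integrableOn_yh t).mono_set (Icc_subset_Icc_left hs))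

theorem uncertainty_outputFrom (hX : S.IsRun X) {t : ℝ} (ht : 0 ≤ t) :
    S.Δ.outputFrom 0 0 X.uh t = S.d X t := by
  have h := S.Δ.outputFrom_of_hasDerivWithinAt (w := X.uh) ht
    (hX.ξ_cont.mono Icc_subset_Ici_self) (fun τ hτ => hX.ξ_deriv τ hτ.1) (hX.integrableOn_uh t)
  rw [hX.ξ_zero] at h
  exact h

/-- The operator `Γ`, started at time `s`, yields the signals of the loop. -/
theorem εd_eq (hX : S.IsRun X) {s t : ℝ} (hs : 0 ≤ s) (hst : s ≤ t) :
    S.εd X t = Sum.elim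
      (Sum.elim
        (X.yh t - S.plant.outputFrom s (X.xp s) X.uh t - S.Δ.outputFrom 0 0 X.uh t)
        (X.uh t - S.K.outputFrom s (X.xk s) X.yh t))
      (S.Δ.outputFrom 0 0 X.uh t) := by
  rw [hX.plant_outputFrom hs hst, hX.controller_outputFrom hs hst,
    hX.uncertainty_outputFrom (hs.trans hst), sub_sub]
  rfl

theorem εd_eq_Γ (hX : S.IsRun X) {t : ℝ} (ht : 0 ≤ t) :
    S.εd X t = S.Γ (X.xp 0) (X.xk 0) X.v t :=
  hX.εd_eq le_rfl ht

theorem v_mem_admissible (hX : S.IsRun X) (hΩ₁ : S.Ω₁.PosDef) (hΩ₂ : S.Ω₂.PosDef)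
    (hμ : 0 < S.μ) : X.v ∈ S.admissible (X.xp 0) (X.xk 0) := by
  refine (ae_restrict_iff' measurableSet_Ici).2 (Filter.Eventually.of_forall fun t ht => ?_)
  have h : S.Γε (X.xp 0) (X.xk 0) X.v t = S.ε X t :=
    (congrArg (fun f => f ∘ Sum.inl) (hX.εd_eq_Γ ht)).symm
  rw [h]
  exact hX.trigger_nonpos hΩ₁ hΩ₂ hμ ht

end Loop.IsRun

end ETC

theorem theorem1 {n nK nΔ p m : ℕ} (hpm : 0 < p + m) (S : ETC.Loop n nK nΔ p m)
    (hΩ₁ : S.Ω₁.PosDef) (hΩ₂ : S.Ω₂.PosDef) (hμ : 0 < S.μ) (hν : 0 < S.ν)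
    (η : ℝ) (hη : 0 ≤ η) (hΔ : S.Δ.Stable) (hΔη : S.Δ.hinfNorm ≤ ENNReal.ofReal η) :
    -- for all initial states, `Γ` is an affine operator, and it is finite-gain `L²` stable on the
    -- signals admitted by the triggering mechanism, with gain `γ` and bias independent of the
    -- initial states; in quadratic form the bias is `μ / ν` in the time domain and `2πμ / ν` in
    -- the frequency domain
    (∀ (xp₀ : Fin n → ℝ) (xk₀ : Fin nK → ℝ),
      ETC.IsAffineOperator (S.Γ xp₀ xk₀) ∧
      ETC.FiniteGainOn (S.admissible xp₀ xk₀) (S.Γ xp₀ xk₀) (S.gain η) √(S.μ / S.ν) ∧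
      ∀ v ∈ S.admissible xp₀ xk₀, ETC.MemL2 v →
        ETC.energy (S.Γ xp₀ xk₀ v) ≤ S.gain η ^ 2 * ETC.energy v + S.μ / S.ν ∧
        ETC.freqEnergy (S.Γ xp₀ xk₀ v)
          ≤ S.gain η ^ 2 * ETC.freqEnergy v + 2 * Real.pi * S.μ / S.ν) ∧
    -- on every run of the closed loop, `v` is admitted and `(ε, d) = Γ v`
    (∀ X : ETC.Traj n nK nΔ p m, S.IsRun X →
      X.v ∈ S.admissible (X.xp 0) (X.xk 0) ∧
      (∀ t : ℝ, 0 ≤ t → S.εd X t = S.Γ (X.xp 0) (X.xk 0) X.v t) ∧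
      -- the same operator, expressed on the interval `[t_k, t_{k+1})`
      (∀ k (t : ℝ), X.T k ≤ (t : EReal) → (t : EReal) < X.T (k + 1) →
        S.εd X t = Sum.elim
          (Sum.elim
            (X.yh t - S.plant.outputFrom (X.T k).toReal (X.xp (X.T k).toReal) X.uh t
              - S.Δ.outputFrom 0 0 X.uh t)
            (X.uh t - S.K.outputFrom (X.T k).toReal (X.xk (X.T k).toReal) X.yh t))
          (S.Δ.outputFrom 0 0 X.uh t)) ∧
      -- the resulting estimates for the signals of the loop
      (ETC.MemL2 X.v →
        ETC.MemL2 (S.εd X) ∧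
        ETC.l2norm (S.εd X) ≤ S.gain η * ETC.l2norm X.v + √(S.μ / S.ν) ∧
        ETC.energy (S.εd X) ≤ S.gain η ^ 2 * ETC.energy X.v + S.μ / S.ν ∧
        ETC.freqEnergy (S.εd X)
          ≤ S.gain η ^ 2 * ETC.freqEnergy X.v + 2 * Real.pi * S.μ / S.ν)) := by
  have hγ := S.gain_pos hpm hΩ₁ hΩ₂ η
  have key : ∀ (xp₀ : Fin n → ℝ) (xk₀ : Fin nK → ℝ), ∀ v ∈ S.admissible xp₀ xk₀, ETC.MemL2 v →
      ETC.MemL2 (S.Γ xp₀ xk₀ v) ∧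
      ETC.l2norm (S.Γ xp₀ xk₀ v) ≤ S.gain η * ETC.l2norm v + √(S.μ / S.ν) ∧
      ETC.energy (S.Γ xp₀ xk₀ v) ≤ S.gain η ^ 2 * ETC.energy v + S.μ / S.ν ∧
      ETC.freqEnergy (S.Γ xp₀ xk₀ v)
        ≤ S.gain η ^ 2 * ETC.freqEnergy v + 2 * Real.pi * S.μ / S.ν := by
    intro xp₀ xk₀ v hadm hv
    obtain ⟨h1, h2⟩ := S.memL2_Γ_and_energy_le xp₀ xk₀ hΩ₁ hΩ₂ hν hη hΔ hΔη hadm hv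
    refine ⟨h1, ETC.l2norm_le_of_energy_le hγ.le (div_pos hμ hν).le h2, h2, ?_⟩
    rw [ETC.freqEnergy_eq h1, ETC.freqEnergy_eq hv]
    calc _ ≤ 2 * Real.pi * (S.gain η ^ 2 * ETC.energy v + S.μ / S.ν) :=
          mul_le_mul_of_nonneg_left h2 Real.two_pi_pos.le
      _ = _ := by ring
  refine ⟨fun xp₀ xk₀ => ⟨S.isAffineOperator_Γ xp₀ xk₀,
    ⟨hγ, Real.sqrt_pos.2 (div_pos hμ hν), fun v hadm hv => ?_⟩, fun v hadm hv => ?_⟩,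
    fun X hX => ⟨hX.v_mem_admissible hΩ₁ hΩ₂ hμ, fun t ht => hX.εd_eq_Γ ht,
      fun k t h1 _ => hX.εd_eq (hX.toReal_T_nonneg k) (hX.toReal_T_le h1), fun hv => ?_⟩⟩
  · exact ⟨(key xp₀ xk₀ v hadm hv).1, (key xp₀ xk₀ v hadm hv).2.1⟩
  · exact (key xp₀ xk₀ v hadm hv).2.2
  · obtain ⟨h1, h2, h3, h4⟩ := key _ _ X.v (hX.v_mem_admissible hΩ₁ hΩ₂ hμ) hv
    have hΓ : ∀ t, 0 ≤ t → S.Γ (X.xp 0) (X.xk 0) X.v t = S.εd X t := fun t ht =>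
      (hX.εd_eq_Γ ht).symm
    have hε := h1.congr hΓ
    have he := ETC.energy_congr hΓ
    rw [ETC.l2norm, he] at h2
    rw [he] at h3
    -- The two signals agree only for `t ≥ 0`, so the frequency bound is transferred through the
    -- time-domain energy.
    rw [ETC.freqEnergy_eq h1, he, ← ETC.freqEnergy_eq hε] at h4
    exact ⟨hε, h2, h3, h4⟩
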